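/- Let $E\to B$ be an elliptic surface in Weierstrass form, $y^2=4x^3-g_2x-g_3$, where $g_2,g_3$ are functions on the base $B$ (in a local trivialization), so that the fiber $E_b$, $b\in B$, is the complex projective plane cubic with affine equation $y^2=4x^3-g_2(b)x-g_3(b)$. Put $\Delta(E_b)=g_2(b)^3-27g_3(b)^2$ and, if $\Delta(E_b)\neq 0$, $J(E_b)=g_2(b)^3/\Delta(E_b)$. Let ${}_2F_1(\tfrac1{12},\tfrac5{12};1;\cdot)$ denote the (multivalued) analytic function on $\mathbf C\setminus\{0,1\}$ obtained from the hypergeometric series $\sum_{n\ge0}\frac{(1/12)_n(5/12)_n}{(1)_n\,n!}w^n$, $|w|<1$, by analytic continuation along paths in $\mathbf C\setminus\{0,1\}$ that start in the punctured unit disc. Then for every $b\in B$ such that $E_b$ is nonsingular, i.e. $\Delta(E_b)\neq 0$, and $J(E_b)\neq 0,1$, the function ${}_2F_1(\tfrac1{12},\tfrac5{12};1;\cdot)$ has at least one value at $1/J(E_b)$, and for every such value there is a primitive class $\gamma_b\in H_1(E_b,\mathbf Z)$ (that is, $\gamma_b=n\beta$ with $n\in\mathbf Z$, $\beta\in H_1(E_b,\mathbf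 Z)$ only for $n=\pm1$) with $$g_2(b)^{1/4}\int_{\gamma_b}\frac{\mathrm dx}{y}=c\cdot{}_2F_1\!\left(\tfrac1{12},\tfrac5{12};1;\tfrac1{J(E_b)}\right),\qquad c=\frac{2\pi}{\sqrt[4]{12}},$$ up to multiplication by a fourth root of unity, for any choice of the fourth root $g_2(b)^{1/4}$. -/

import Mathlib

open CategoryTheory

noncomputable section

/-! ### Plane cubics in Weierstrass form -/

/-- A complex plane cubic `y² = 4x³ - g₂x - g₃` in Weierstrass form. -/
structure WeierstrassCubic where
  g₂ : ℂ
  g₃ : ℂ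

/-- The complex projective plane carries the quotient topology of `ℂ³ ∖ {0}`. -/
instance projectivePlaneTopology : TopologicalSpace (Projectivization ℂ (Fin 3 → ℂ)) :=
  TopologicalSpace.coinduced
    (fun v : {v : Fin 3 → ℂ // v ≠ 0} => Projectivization.mk ℂ v.1 v.2) inferInstance

/-- The affine point `(x, y)`, that is `[x : y : 1]`, of the projective plane. -/
def affineToProjective (q : ℂ × ℂ) : Projectivization ℂ (Fin 3 → ℂ) :=
  Projectivization.mk ℂ ![q.1, q.2, 1] (fun h => by simpa using congrFun h 2)

theorem continuous_affineToProjective : Continuous affineToProjective := by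
  have h : Continuous (fun q : ℂ × ℂ =>
      (⟨![q.1, q.2, 1], fun h => by simpa using congrFun h 2⟩ : {v : Fin 3 → ℂ // v ≠ 0})) := by
    refine Continuous.subtype_mk (continuous_pi fun i => ?_) _
    fin_cases i
    · exact continuous_fst
    · exact continuous_snd
    · exact continuous_const
  exact (continuous_coinduced_rng (f := fun v : {v : Fin 3 → ℂ // v ≠ 0} =>
    Projectivization.mk ℂ v.1 v.2)).comp h

namespace WeierstrassCubic

variable (C : WeierstrassCubic)

/-- The discriminant `Δ = g₂³ - 27 g₃²`; the cubic is nonsingular iff `Δ ≠ 0`. -/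
def disc : ℂ := C.g₂ ^ 3 - 27 * C.g₃ ^ 2

/-- The invariant `J = g₂³ / Δ`. -/
def J : ℂ := C.g₂ ^ 3 / C.disc

/-- The affine equation `y² = 4x³ - g₂x - g₃`. -/
def AffineEq (x y : ℂ) : Prop := y ^ 2 = 4 * x ^ 3 - C.g₂ * x - C.g₃

/-- The homogeneous equation `y²z = 4x³ - g₂xz² - g₃z³` in homogeneous coordinates
`v = (x, y, z)`. -/
def HomogeneousEq (v : Fin 3 → ℂ) : Prop :=
  v 1 ^ 2 * v 2 = 4 * v 0 ^ 3 - C.g₂ * v 0 * v 2 ^ 2 - C.g₃ * v 2 ^ 3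

theorem homogeneousEq_smul {v : Fin 3 → ℂ} {a : ℂ} (ha : a ≠ 0) :
    C.HomogeneousEq (a • v) ↔ C.HomogeneousEq v := by
  unfold HomogeneousEq
  simp only [Pi.smul_apply, smul_eq_mul]
  constructor
  · intro h
    apply mul_left_cancel₀ (pow_ne_zero 3 ha)
    linear_combination h
  · intro h
    linear_combination a ^ 3 * h

/-- The points of the projective cubic, a subspace of the projective plane (the condition does not
depend on the representative, see `homogeneousEq_rep_mk`). -/
def Points : Type := {P : Projectivization ℂ (Fin 3 → ℂ) // C.HomogeneousEq P.rep}

instance : TopologicalSpace C.Points := instTopologicalSpaceSubtype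

theorem homogeneousEq_rep_mk (v : Fin 3 → ℂ) (hv : v ≠ 0) :
    C.HomogeneousEq (Projectivization.mk ℂ v hv).rep ↔ C.HomogeneousEq v := by
  obtain ⟨a, ha⟩ := Projectivization.exists_smul_eq_mk_rep ℂ v hv
  rw [← ha, Units.smul_def]
  exact C.homogeneousEq_smul a.ne_zero

theorem homogeneousEq_affineToProjective {q : ℂ × ℂ} (h : C.AffineEq q.1 q.2) :
    C.HomogeneousEq (affineToProjective q).rep := by
  unfold affineToProjective
  rw [homogeneousEq_rep_mk]
  unfold AffineEq at h
  simp [HomogeneousEq, h]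

/-! ### First homology and periods -/

/-- The singular chain complex of the projective cubic with integer coefficients. -/
abbrev chains : ChainComplex (ModuleCat.{0} ℤ) ℕ :=
  ((AlgebraicTopology.singularChainComplexFunctor (ModuleCat.{0} ℤ)).obj
    (ModuleCat.of ℤ ℤ)).obj (TopCat.of C.Points)

/-- The first singular homology group `H₁(C, ℤ)` of the projective cubic. -/
abbrev H₁ : ModuleCat.{0} ℤ :=
  ((AlgebraicTopology.singularHomologyFunctor (ModuleCat.{0} ℤ) 1).obj
    (ModuleCat.of ℤ ℤ)).obj (TopCat.of C.Points)

/-- The elementary singular `1`-chain `1 · σ` of a singular `1`-simplex `σ`. -/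
def simplexChain (σ : C(stdSimplex ℝ (Fin 2), C.Points)) : C.chains.X 1 :=
  ((TopCat.toSSet.obj (TopCat.of C.Points)).ιChainComplex (R := ModuleCat.of ℤ ℤ) (n := 1)
    ((TopCat.toSSetObjEquiv (TopCat.of C.Points) (.op (.mk 1))).symm σ)).hom (1 : ℤ)

/-- A closed `C¹` curve `t ↦ (x(t), y(t))`, `0 ≤ t ≤ 1`, in the affine part of the cubic. -/
structure AffineLoop where
  x : ℝ → ℂ
  y : ℝ → ℂ
  contDiff_x : ContDiff ℝ 1 x
  contDiff_y : ContDiff ℝ 1 y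
  mem : ∀ t ∈ Set.Icc (0 : ℝ) 1, C.AffineEq (x t) (y t)
  x_closed : x 0 = x 1
  y_closed : y 0 = y 1

namespace AffineLoop

variable {C} (γ : C.AffineLoop)

/-- The singular `1`-simplex given by a closed curve; the parameter is the second barycentric
coordinate. -/
def simplex : C(stdSimplex ℝ (Fin 2), C.Points) where
  toFun p := ⟨affineToProjective (γ.x (p.1 1), γ.y (p.1 1)),
    C.homogeneousEq_affineToProjective
      (γ.mem _ ⟨p.2.1 1, (Finset.single_le_sum (fun i _ => p.2.1 i) (Finset.mem_univ 1)).trans_eq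
        p.2.2⟩)⟩
  continuous_toFun := by
    refine Continuous.subtype_mk (continuous_affineToProjective.comp ?_) _
    have h : Continuous fun p : stdSimplex ℝ (Fin 2) => p.1 1 :=
      (continuous_apply 1).comp continuous_subtype_val
    exact (γ.contDiff_x.continuous.comp h).prodMk (γ.contDiff_y.continuous.comp h)

/-- The homology class `α` is the class of the closed curve `γ`. -/
def Represents (α : C.H₁) : Prop :=
  ∃ z : C.chains.cycles 1,
    (C.chains.iCycles 1).hom z = C.simplexChain γ.simplex ∧ (C.chains.homologyπ 1).hom z = α

/-- The integral of the `1`-form `dx/y` over a closed curve. Where `y = 0` the form is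
`2dy/(12x² - g₂)`, by the relation `2y dy = (12x² - g₂) dx` on the cubic. -/
def integral : ℂ :=
  ∫ t in (0 : ℝ)..1,
    open Classical in
    if γ.y t = 0 then 2 * deriv γ.y t / (12 * γ.x t ^ 2 - C.g₂) else deriv γ.x t / γ.y t

end AffineLoop

/-- `I` is the period `∫_α dx/y` of the class `α`: the integral over a closed `C¹` curve in the
class. The form is holomorphic on a nonsingular cubic, so that the integral depends on the class
only, and every class contains such a curve avoiding the point at infinity. -/
def HasPeriod (α : C.H₁) (I : ℂ) : Prop := ∃ γ : C.AffineLoop, γ.Represents α ∧ γ.integral = I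

end WeierstrassCubic

/-- An element of an abelian group is primitive if it is not a multiple `n • β`, except for
`n = ±1`. -/
def IsPrimitiveElement {M : Type*} [AddCommGroup M] (α : M) : Prop :=
  ∀ (n : ℤ) (β : M), α = n • β → n = 1 ∨ n = -1

/-! ### The hypergeometric function -/

/-- The germs of `F t` at `p t` form an analytic continuation along the path `p` of the germ of `f`
at its starting point. -/
structure IsAnalyticContinuation (f : ℂ → ℂ) (p : C(unitInterval, ℂ)) (F : unitInterval → ℂ → ℂ) :
    Prop where
  start : F 0 =ᶠ[nhds (p 0)] f
  analyticAt : ∀ t, AnalyticAt ℂ (F t) (p t)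
  compatible : ∀ t, ∀ᶠ s in nhds t, F s =ᶠ[nhds (p s)] F t

/-- `v` is a value at `w` of the (multivalued) hypergeometric function `₂F₁(a, b; c; ·)`: the value
of the analytic continuation of the hypergeometric series along a path in `ℂ ∖ {0, 1}` which
starts in the unit disc and ends at `w`. -/
def IsHypergeometricValue (a b c w v : ℂ) : Prop :=
  ∃ (p : C(unitInterval, ℂ)) (F : unitInterval → ℂ → ℂ),
    ‖p 0‖ < 1 ∧ (∀ t, p t ≠ 0 ∧ p t ≠ 1) ∧ p 1 = w ∧
      IsAnalyticContinuation (ordinaryHypergeometric a b c) p F ∧ F 1 w = v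

end

/-! On the upper half plane put `J = E₄³ / (E₄³ - E₆²)`. The whole statement rests on the identity
`₂F₁(1/12, 5/12; 1; 1/J)⁴ = E₄`, valid near the cusp. There `1/J` is a local coordinate in `q`, and
Ramanujan's equations for `E₂, E₄, E₆` show that `E₄^(1/4)`, as a function of `1/J`, satisfies the
hypergeometric equation. That equation has only one solution holomorphic at `0` with value `1` there
(`ordinaryHypergeometric_of_ramanujan`).

The identity survives continuation along any path avoiding `0`: the value `v` reached at `w`
satisfies `v⁴ = E₄(τ)` for some `τ` with `J(τ) = 1/w` (`IsHypergeometricValue.exists_pow_four_eq`).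
The set of times at which the relation holds is open because `J` is an open map. It is closed
because `J` is proper modulo `SL(2, ℤ)`. Which `τ` occurs depends on the path, and this is why the
period class depends on the chosen value.

Given such a `τ` over `w = 1/J(C)`, equality of the invariants makes `C` the cubic of a lattice `l(ℤ
+ ℤτ)`, and `g₂ l⁴ = (4/3)π⁴ E₄(τ) = (4/3)π⁴ v⁴ = (c v)⁴`. So `l` is the required period up to a
fourth root of unity. It is the integral of `dx/y = dz` over the image of a segment parallel to `l`.
The class of this loop is primitive because the coordinate along `l` is a circle-valued function on
the cubic with winding number one along it; the winding defines an integral linear form on `H₁` with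
value `1` on the class.

That some value exists is shown upstairs. `J` is surjective, a segment in the upper half plane
avoiding the zeros of `E₄E₆` joins a preimage to the neighbourhood of the cusp, and a branch of
`E₄^(1/4)` along the segment descends through `1/J`, which is locally invertible there. -/

noncomputable section

/-! ### Integral cocycles from circle-valued maps -/

/-- A circle-valued map on a simplex lifts to a real-valued map. -/
theorem exists_lift_stdSimplex {n : ℕ} (g : C(stdSimplex ℝ (Fin (n + 1)), AddCircle (1 : ℝ))) :
    ∃ T : C(stdSimplex ℝ (Fin (n + 1)), ℝ), ∀ p, ((T p : ℝ) : AddCircle (1 : ℝ)) = g p := by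
  let v : stdSimplex ℝ (Fin (n + 1)) := stdSimplex.vertex 0
  obtain ⟨a, ha⟩ := QuotientAddGroup.mk_surjective (g v)
  let K : unitInterval × stdSimplex ℝ (Fin (n + 1)) → stdSimplex ℝ (Fin (n + 1)) := fun q =>
    ⟨AffineMap.lineMap (v : Fin (n + 1) → ℝ) (q.2 : Fin (n + 1) → ℝ) (q.1 : ℝ),
      (convex_stdSimplex ℝ (Fin (n + 1))).lineMap_mem v.2 q.2.2 q.1.2⟩
  have hK : Continuous K := by
    refine Continuous.subtype_mk ?_ _
    simp only [AffineMap.lineMap_apply_module]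
    fun_prop
  let H : C(unitInterval × stdSimplex ℝ (Fin (n + 1)), AddCircle (1 : ℝ)) := g.comp ⟨K, hK⟩
  have H0 : ∀ p, H (0, p) = ((ContinuousMap.const _ a : C(stdSimplex ℝ (Fin (n + 1)), ℝ)) p :
      AddCircle (1 : ℝ)) := by
    intro p
    have : K (0, p) = v := by
      apply Subtype.ext
      simp only [K, Set.Icc.coe_zero, AffineMap.lineMap_apply_zero]
      rfl
    simp [H, this, ← ha]
  refine ⟨((AddCircle.isCoveringMap_coe (1 : ℝ)).liftHomotopy H _ H0).comp
    ((ContinuousMap.const _ 1).prodMk (ContinuousMap.id _)), fun p => ?_⟩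
  have h1 : K (1, p) = p := by
    apply Subtype.ext
    simp only [K, Set.Icc.coe_one, AffineMap.lineMap_apply_one]
    rfl
  have := congrFun ((AddCircle.isCoveringMap_coe (1 : ℝ)).liftHomotopy_lifts H _ H0) (1, p)
  simpa [H, h1] using this

/-- Two real lifts of a circle-valued map on a simplex differ by a constant. -/
theorem lift_sub_lift_eq {n : ℕ} (T T' : C(stdSimplex ℝ (Fin (n + 1)), ℝ))
    (h : ∀ p, ((T p : ℝ) : AddCircle (1 : ℝ)) = (T' p : ℝ)) (p q : stdSimplex ℝ (Fin (n + 1))) :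
    T p - T' p = T q - T' q := by
  have hint : ∀ p, ∃ m : ℤ, (m : ℝ) = T p - T' p := by
    intro p
    have := (QuotientAddGroup.eq_iff_sub_mem).1 (h p)
    obtain ⟨m, hm⟩ := AddSubgroup.mem_zmultiples_iff.1 this
    exact ⟨m, by simpa using hm⟩
  choose m hm using hint
  have hc : Continuous m := by
    have : Continuous fun p => ((m p : ℤ) : ℝ) := by
      simp only [hm]
      fun_prop
    exact Int.isClosedEmbedding_coe_real.isEmbedding.continuous_iff.2 this
  have : PreconnectedSpace (stdSimplex ℝ (Fin (n + 1))) :=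
    Subtype.preconnectedSpace (convex_stdSimplex ℝ (Fin (n + 1))).isPreconnected
  rw [← hm, ← hm, PreconnectedSpace.constant this hc]

section Winding

variable {X : Type} [TopologicalSpace X] (f : C(X, AddCircle (1 : ℝ)))

/-- A set-theoretic section of the projection of the line to the circle. -/
def circleSection (a : AddCircle (1 : ℝ)) : ℝ := Function.surjInv QuotientAddGroup.mk_surjective a

theorem coe_circleSection (a : AddCircle (1 : ℝ)) : ((circleSection a : ℝ) : AddCircle (1 : ℝ)) = a :=
  Function.surjInv_eq QuotientAddGroup.mk_surjective a

/-- Subtracting the section makes each end term project to zero on the circle, so the difference is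
an integer even when the simplex is not closed. Two lifts differ by a constant, which cancels. -/
theorem exists_winding (σ : C(stdSimplex ℝ (Fin 2), X)) :
    ∃ m : ℤ, ∀ T : C(stdSimplex ℝ (Fin 2), ℝ), (∀ p, ((T p : ℝ) : AddCircle (1 : ℝ)) = f (σ p)) →
      (m : ℝ) = (T (stdSimplex.vertex 1) - circleSection (f (σ (stdSimplex.vertex 1)))) -
        (T (stdSimplex.vertex 0) - circleSection (f (σ (stdSimplex.vertex 0)))) := by
  obtain ⟨T, hT⟩ := exists_lift_stdSimplex (f.comp σ)
  have key : ((((T (stdSimplex.vertex 1) - circleSection (f (σ (stdSimplex.vertex 1)))) -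
        (T (stdSimplex.vertex 0) - circleSection (f (σ (stdSimplex.vertex 0)))) : ℝ)) :
        AddCircle (1 : ℝ)) = 0 := by
    push_cast
    simp [coe_circleSection, hT]
  obtain ⟨m, hm⟩ := (AddCircle.coe_eq_zero_iff (1 : ℝ)).1 key
  refine ⟨m, fun T' hT' => ?_⟩
  have := lift_sub_lift_eq T T' (fun p => by rw [hT, hT']; rfl) (stdSimplex.vertex 0)
    (stdSimplex.vertex 1)
  simp only [zsmul_eq_mul, mul_one] at hm
  rw [hm]
  linarith

/-- The integral `1`-cocycle of a circle-valued map: the winding along a `1`-simplex, corrected by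
a coboundary. -/
def winding (σ : C(stdSimplex ℝ (Fin 2), X)) : ℤ := (exists_winding f σ).choose

theorem winding_eq (σ : C(stdSimplex ℝ (Fin 2), X)) (T : C(stdSimplex ℝ (Fin 2), ℝ))
    (hT : ∀ p, ((T p : ℝ) : AddCircle (1 : ℝ)) = f (σ p)) :
    (winding f σ : ℝ) = (T (stdSimplex.vertex 1) - circleSection (f (σ (stdSimplex.vertex 1)))) -
        (T (stdSimplex.vertex 0) - circleSection (f (σ (stdSimplex.vertex 0)))) :=
  (exists_winding f σ).choose_spec T hT

/-- The face of a singular `2`-simplex. -/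
def singularFace {n : ℕ} (i : Fin (n + 2)) : C(stdSimplex ℝ (Fin (n + 1)), stdSimplex ℝ (Fin (n + 2))) :=
  ⟨stdSimplex.map i.succAbove, stdSimplex.continuous_map _⟩

theorem singularFace_vertex {n : ℕ} (i : Fin (n + 2)) (j : Fin (n + 1)) :
    singularFace i (stdSimplex.vertex j) = stdSimplex.vertex (i.succAbove j) := by
  simp [singularFace]

/-- A single lift on the whole triangle restricts to lifts on its three faces, so the vertex terms
cancel in pairs. -/
theorem winding_boundary (τ : C(stdSimplex ℝ (Fin 3), X)) :
    winding f (τ.comp (singularFace 0)) - winding f (τ.comp (singularFace 1)) +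
      winding f (τ.comp (singularFace 2)) = 0 := by
  obtain ⟨T, hT⟩ := exists_lift_stdSimplex (f.comp τ)
  have h := fun i : Fin 3 => winding_eq f (τ.comp (singularFace i)) (T.comp (singularFace i))
    (fun p => hT _)
  have h0 := h 0
  have h1 := h 1
  have h2 := h 2
  simp only [ContinuousMap.comp_apply, singularFace_vertex] at h0 h1 h2
  have e : (winding f (τ.comp (singularFace 0)) - winding f (τ.comp (singularFace 1)) +
      winding f (τ.comp (singularFace 2)) : ℝ) = 0 := by
    rw [h0, h1, h2]
    have e00 : (0 : Fin 3).succAbove (0 : Fin 2) = 1 := rfl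
    have e01 : (0 : Fin 3).succAbove (1 : Fin 2) = 2 := rfl
    have e10 : (1 : Fin 3).succAbove (0 : Fin 2) = 0 := rfl
    have e11 : (1 : Fin 3).succAbove (1 : Fin 2) = 2 := rfl
    have e20 : (2 : Fin 3).succAbove (0 : Fin 2) = 0 := rfl
    have e21 : (2 : Fin 3).succAbove (1 : Fin 2) = 1 := rfl
    rw [e00, e01, e10, e11, e20, e21]
    ring
  exact_mod_cast e

variable (X) in
/-- The singular chain complex with integer coefficients. -/
abbrev singularChains : ChainComplex (ModuleCat.{0} ℤ) ℕ :=
  ((AlgebraicTopology.singularChainComplexFunctor (ModuleCat.{0} ℤ)).obj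
    (ModuleCat.of ℤ ℤ)).obj (TopCat.of X)

/-- The inclusion of the summand of the chains given by a singular simplex. -/
def simplexInclusion {n : ℕ} (σ : C(stdSimplex ℝ (Fin (n + 1)), X)) :
    ModuleCat.of ℤ ℤ ⟶ (singularChains X).X n :=
  (TopCat.toSSet.obj (TopCat.of X)).ιChainComplex (R := ModuleCat.of ℤ ℤ) (n := n)
    ((TopCat.toSSetObjEquiv (TopCat.of X) (.op (.mk n))).symm σ)

theorem simplexInclusion_d {n : ℕ} (σ : C(stdSimplex ℝ (Fin (n + 2)), X)) :
    simplexInclusion σ ≫ (singularChains X).d (n + 1) n =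
      ∑ i : Fin (n + 2), (-1) ^ i.val • simplexInclusion (σ.comp (singularFace i)) := by
  have := SSet.ιChainComplex_d (X := TopCat.toSSet.obj (TopCat.of X)) (R := ModuleCat.of ℤ ℤ)
    ((TopCat.toSSetObjEquiv (TopCat.of X) (.op (.mk (n + 1)))).symm σ)
  refine this.trans (Finset.sum_congr rfl fun i _ => ?_)
  -- The faces of the singular simplicial set are, by definition, precompositions with the coface
  -- maps of simplices.
  rfl

theorem simplexInclusion_hom_ext {n : ℕ} {A : ModuleCat.{0} ℤ} {g h : (singularChains X).X n ⟶ A}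
    (H : ∀ σ : C(stdSimplex ℝ (Fin (n + 1)), X), simplexInclusion σ ≫ g = simplexInclusion σ ≫ h) :
    g = h := by
  refine SSet.chainComplex_hom_ext (X := TopCat.toSSet.obj (TopCat.of X)) fun x => ?_
  obtain ⟨σ, rfl⟩ := (TopCat.toSSetObjEquiv (TopCat.of X) (.op (.mk n))).symm.surjective x
  exact H σ

/-- The linear form on singular `1`-chains given by the winding. -/
def windingForm : (singularChains X).X 1 ⟶ ModuleCat.of ℤ ℤ :=
  ((TopCat.toSSet.obj (TopCat.of X)).isColimitChainComplexXCofan (ModuleCat.of ℤ ℤ) 1).desc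
    (Limits.Cofan.mk _ fun x =>
      winding f (TopCat.toSSetObjEquiv (TopCat.of X) (.op (.mk 1)) x) • 𝟙 (ModuleCat.of ℤ ℤ))

theorem simplexInclusion_windingForm (σ : C(stdSimplex ℝ (Fin 2), X)) :
    simplexInclusion σ ≫ windingForm f = winding f σ • 𝟙 (ModuleCat.of ℤ ℤ) := by
  have := ((TopCat.toSSet.obj (TopCat.of X)).isColimitChainComplexXCofan (ModuleCat.of ℤ ℤ) 1).fac
    (Limits.Cofan.mk _ fun x =>
      winding f (TopCat.toSSetObjEquiv (TopCat.of X) (.op (.mk 1)) x) • 𝟙 (ModuleCat.of ℤ ℤ))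
    ⟨(TopCat.toSSetObjEquiv (TopCat.of X) (.op (.mk 1))).symm σ⟩
  refine this.trans ?_
  simp

theorem d_windingForm : (singularChains X).d 2 1 ≫ windingForm f = 0 := by
  refine simplexInclusion_hom_ext fun τ => ?_
  rw [← Category.assoc, simplexInclusion_d]
  simp only [Preadditive.sum_comp, Limits.comp_zero, Linear.smul_comp,
    simplexInclusion_windingForm]
  have := winding_boundary f τ
  rw [Fin.sum_univ_three]
  simp only [smul_smul, ← add_smul]
  convert zero_smul ℤ (𝟙 (ModuleCat.of ℤ ℤ))
  simpa [sub_eq_add_neg] using this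

/-- The linear form on the first homology given by a circle-valued map. -/
def windingHomology : (singularChains X).homology 1 ⟶ ModuleCat.of ℤ ℤ :=
  (singularChains X).homologyι 1 ≫
    (singularChains X).descOpcycles (windingForm f) 2 (by simp) (d_windingForm f)

theorem homologyπ_windingHomology :
    (singularChains X).homologyπ 1 ≫ windingHomology f =
      (singularChains X).iCycles 1 ≫ windingForm f := by
  rw [windingHomology, ← Category.assoc, HomologicalComplex.homology_π_ι, Category.assoc,
    HomologicalComplex.p_descOpcycles]

/-- The two faces of a closed `1`-simplex are the same `0`-simplex, so its boundary vanishes. -/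
theorem exists_cycle_of_loop (σ : C(stdSimplex ℝ (Fin 2), X))
    (hσ : σ (stdSimplex.vertex 0) = σ (stdSimplex.vertex 1)) :
    ∃ z : (singularChains X).cycles 1,
      ((singularChains X).iCycles 1).hom z = (simplexInclusion σ).hom (1 : ℤ) := by
  have hd : simplexInclusion σ ≫ (singularChains X).d 1 0 = 0 := by
    have e : σ.comp (singularFace 0) = σ.comp (singularFace 1) := by
      ext p
      obtain rfl : p = stdSimplex.vertex 0 := Subsingleton.elim _ _
      simp only [ContinuousMap.comp_apply, singularFace_vertex]
      exact hσ.symm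
    rw [simplexInclusion_d, Fin.sum_univ_two, e]
    simp
  refine ⟨((singularChains X).liftCycles (simplexInclusion σ) 0 (by simp) hd).hom (1 : ℤ), ?_⟩
  rw [← LinearMap.comp_apply, ← ModuleCat.hom_comp, HomologicalComplex.liftCycles_i]

theorem windingHomology_eq (σ : C(stdSimplex ℝ (Fin 2), X)) (z : (singularChains X).cycles 1)
    (hz : ((singularChains X).iCycles 1).hom z = (simplexInclusion σ).hom (1 : ℤ)) :
    (windingHomology f).hom (((singularChains X).homologyπ 1).hom z) = winding f σ := by
  rw [← LinearMap.comp_apply, ← ModuleCat.hom_comp, homologyπ_windingHomology, ModuleCat.hom_comp,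
    LinearMap.comp_apply, hz, ← LinearMap.comp_apply, ← ModuleCat.hom_comp,
    simplexInclusion_windingForm]
  simp

/-- A closed singular simplex of winding number one represents a primitive homology class. -/
theorem isPrimitiveElement_of_winding_eq_one (σ : C(stdSimplex ℝ (Fin 2), X))
    (z : (singularChains X).cycles 1)
    (hz : ((singularChains X).iCycles 1).hom z = (simplexInclusion σ).hom (1 : ℤ))
    (hw : winding f σ = 1) :
    IsPrimitiveElement (((singularChains X).homologyπ 1).hom z) := by
  intro n β h
  have h1 := windingHomology_eq f σ z hz
  have h2 : ((windingHomology f).hom (n • β) : ℤ) = n * ((windingHomology f).hom β : ℤ) :=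
    (map_zsmul (windingHomology f).hom n β).trans (smul_eq_mul _ _)
  rw [hw, h, h2] at h1
  -- The linear form takes the value `1` on the class, so `n` divides `1`.
  exact Int.isUnit_iff.1 (IsUnit.of_mul_eq_one _ h1)

end Winding

/-! ### The Weierstrass function as a parametrization of the cubic -/

section LinearODE

open Filter Topology

/-- An analytic solution of `y'' = a y` with vanishing initial values vanishes. -/
theorem eventually_eq_zero_of_deriv_deriv_eq_mul {d a : ℂ → ℂ} {z : ℂ} (hd : AnalyticAt ℂ d z)
    (ha : AnalyticAt ℂ a z) (h : deriv (deriv d) =ᶠ[𝓝 z] a * d) (h0 : d z = 0)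
    (h1 : deriv d z = 0) : ∀ᶠ t in 𝓝 z, d t = 0 := by
  -- Differentiating twice lowers the order of vanishing by two, while multiplying by `a` cannot
  -- lower it. Hence the order of `d` is infinite.
  have e1 := hd.analyticOrderAt_deriv_add_one
  have e2 := hd.deriv.analyticOrderAt_deriv_add_one
  simp only [h0, h1, sub_zero] at e1 e2
  rw [analyticOrderAt_congr h, analyticOrderAt_mul ha hd] at e2
  rw [← analyticOrderAt_eq_top]
  change _ = analyticOrderAt d z at e1
  change _ = analyticOrderAt (deriv d) z at e2
  rw [← e2] at e1
  generalize analyticOrderAt d z = m at *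
  generalize analyticOrderAt a z = k at *
  by_contra hm
  lift m to ℕ using hm
  cases k with
  | top => simp at e1
  | coe k =>
    norm_cast at e1
    omega

end LinearODE

namespace PeriodPair

open Filter Topology

variable (L : PeriodPair)

theorem isOpen_compl_lattice : IsOpen ((L.lattice : Set ℂ)ᶜ) := L.isClosed_lattice.isOpen_compl

theorem countable_lattice : (L.lattice : Set ℂ).Countable := by
  have : Countable L.lattice := L.latticeEquivProd.toEquiv.countable_iff.2 inferInstance
  exact Set.countable_coe_iff.1 this

theorem isPreconnected_compl_lattice : IsPreconnected ((L.lattice : Set ℂ)ᶜ) :=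
  (L.countable_lattice.isConnected_compl_of_one_lt_rank (by simp)).isPreconnected

theorem hasDerivAt_weierstrassP {z : ℂ} (hz : z ∉ L.lattice) :
    HasDerivAt L.weierstrassP (L.derivWeierstrassP z) z := by
  rw [← L.deriv_weierstrassP]
  exact (L.analyticOnNhd_weierstrassP z hz).differentiableAt.hasDerivAt

theorem tendsto_weierstrassP_cobounded {l : ℂ} (hl : l ∈ L.lattice) :
    Tendsto L.weierstrassP (𝓝[≠] l) (Bornology.cobounded ℂ) :=
  tendsto_cobounded_of_meromorphicOrderAt_neg (by
    rw [L.order_weierstrassP l hl]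
    exact WithTop.coe_lt_coe.2 (by norm_num : (-2 : ℤ) < 0))

theorem eventually_punctured_notMem_lattice (l : ℂ) : ∀ᶠ z in 𝓝[≠] l, z ∉ L.lattice := by
  filter_upwards [self_mem_nhdsWithin, mem_nhdsWithin_of_mem_nhds
    (L.compl_lattice_sdiff_singleton_mem_nhds l)] with w hw hw'
  simp_all

/-- Otherwise `℘` would be constant on the connected complement of the lattice, contrary to its pole
at `0`. -/
theorem exists_derivWeierstrassP_ne_zero : ∃ z, z ∉ L.lattice ∧ L.derivWeierstrassP z ≠ 0 := by
  by_contra! H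
  have hconst : ∃ c, ∀ z ∉ L.lattice, L.weierstrassP z = c := by
    refine L.isOpen_compl_lattice.exists_is_const_of_deriv_eq_zero L.isPreconnected_compl_lattice
      L.differentiableOn_weierstrassP fun z hz => ?_
    rw [L.deriv_weierstrassP]
    exact H z hz
  obtain ⟨c, hc⟩ := hconst
  have h := L.tendsto_weierstrassP_cobounded (zero_mem L.lattice)
  have h1 : Tendsto L.weierstrassP (𝓝[≠] 0) (𝓝 c) :=
    tendsto_const_nhds.congr' (by
      filter_upwards [L.eventually_punctured_notMem_lattice 0] with z hz
      exact (hc z hz).symm)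
  exact h1.not_tendsto (Metric.disjoint_nhds_cobounded c) h

/-- Differentiating the cubic relation gives this up to a factor `℘'`. The factor cancels because
analytic functions on a connected set have no zero divisors. -/
theorem deriv_derivWeierstrassP {z : ℂ} (hz : z ∉ L.lattice) :
    deriv L.derivWeierstrassP z = 6 * L.weierstrassP z ^ 2 - L.g₂ / 2 := by
  have hP := L.analyticOnNhd_weierstrassP
  have hP' := L.analyticOnNhd_derivWeierstrassP
  have key : ∀ w ∈ (L.lattice : Set ℂ)ᶜ, L.derivWeierstrassP w *
      (deriv L.derivWeierstrassP w - (6 * L.weierstrassP w ^ 2 - L.g₂ / 2)) = 0 := by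
    intro w hw
    have h1 : HasDerivAt (fun w => L.derivWeierstrassP w ^ 2)
        (2 * L.derivWeierstrassP w * deriv L.derivWeierstrassP w) w := by
      simpa using (hP' w hw).differentiableAt.hasDerivAt.fun_pow 2
    have hd := L.hasDerivAt_weierstrassP hw
    have h2 : HasDerivAt (fun w => 4 * L.weierstrassP w ^ 3 - L.g₂ * L.weierstrassP w - L.g₃)
        (4 * (3 * L.weierstrassP w ^ 2 * L.derivWeierstrassP w) - L.g₂ * L.derivWeierstrassP w) w := by
      simpa using (((hd.fun_pow 3).const_mul 4).fun_sub (hd.const_mul L.g₂)).sub_const L.g₃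
    have h3 : (fun w => L.derivWeierstrassP w ^ 2) =ᶠ[𝓝 w]
        fun w => 4 * L.weierstrassP w ^ 3 - L.g₂ * L.weierstrassP w - L.g₃ := by
      filter_upwards [L.isOpen_compl_lattice.mem_nhds hw] with t ht
      exact L.derivWeierstrassP_sq t ht
    have := h1.unique (h2.congr_of_eventuallyEq h3)
    linear_combination this / 2
  have hf : AnalyticOnNhd ℂ (fun w => deriv L.derivWeierstrassP w -
      (6 * L.weierstrassP w ^ 2 - L.g₂ / 2)) (L.lattice : Set ℂ)ᶜ := fun w hw => by
    have := hP w hw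
    have := (hP' w hw).deriv
    fun_prop
  rcases hP'.eq_zero_or_eq_zero_of_mul_eq_zero hf key L.isPreconnected_compl_lattice with h | h
  · obtain ⟨w, hw, hw'⟩ := L.exists_derivWeierstrassP_ne_zero
    exact absurd (h w hw) hw'
  · exact sub_eq_zero.1 (h z hz)

/-- The point `(℘(z), ℘'(z))` of the cubic determines `z` modulo the lattice. -/
theorem sub_mem_lattice_of_weierstrassP_eq {z u : ℂ} (hz : z ∉ L.lattice) (hu : u ∉ L.lattice)
    (h : L.weierstrassP z = L.weierstrassP u)
    (h' : L.derivWeierstrassP z = L.derivWeierstrassP u) : z - u ∈ L.lattice := by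
  have key : ∀ v ∉ L.lattice, ∀ᶠ t in 𝓝 (0 : ℂ), v + t ∉ L.lattice := fun v hv =>
    (by fun_prop : ContinuousAt (fun t : ℂ => v + t) 0).eventually
      (L.isOpen_compl_lattice.mem_nhds (by simpa using hv))
  have hA : ∀ v t, v + t ∉ L.lattice → AnalyticAt ℂ (fun t => L.weierstrassP (v + t)) t :=
    fun v t hv => (L.analyticOnNhd_weierstrassP (v + t) hv).comp (f := fun t => v + t) (by fun_prop)
  have hD : ∀ v t, v + t ∉ L.lattice →
      HasDerivAt (fun t => L.weierstrassP (v + t)) (L.derivWeierstrassP (v + t)) t :=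
    fun v t hv => (L.hasDerivAt_weierstrassP hv).comp_const_add v t
  have hD' : ∀ v t, v + t ∉ L.lattice → HasDerivAt (fun t => L.derivWeierstrassP (v + t))
      (6 * L.weierstrassP (v + t) ^ 2 - L.g₂ / 2) t := fun v t hv => by
    have := (L.analyticOnNhd_derivWeierstrassP (v + t) hv).differentiableAt.hasDerivAt
    rw [L.deriv_derivWeierstrassP hv] at this
    exact this.comp_const_add v t
  have hz0 : z + 0 ∉ L.lattice := by simpa using hz
  have hu0 : u + 0 ∉ L.lattice := by simpa using hu
  have hd1 : ∀ t, z + t ∉ L.lattice → u + t ∉ L.lattice →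
      HasDerivAt (fun t => L.weierstrassP (z + t) - L.weierstrassP (u + t))
        (L.derivWeierstrassP (z + t) - L.derivWeierstrassP (u + t)) t := fun t h1 h2 =>
    (hD z t h1).sub (hD u t h2)
  -- Since `℘'' = 6℘² - g₂/2`, the difference `d` of the two translates solves `d'' = 6(℘(z+t) +
  -- ℘(u+t)) d` with zero initial values.
  have hev := eventually_eq_zero_of_deriv_deriv_eq_mul
    (d := fun t => L.weierstrassP (z + t) - L.weierstrassP (u + t))
    (a := fun t => 6 * (L.weierstrassP (z + t) + L.weierstrassP (u + t))) (z := 0)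
    ((hA z 0 hz0).sub (hA u 0 hu0)) (analyticAt_const.mul ((hA z 0 hz0).add (hA u 0 hu0))) (by
      filter_upwards [(key z hz).eventually_nhds, (key u hu).eventually_nhds] with t h1 h2
      have e : deriv (fun t => L.weierstrassP (z + t) - L.weierstrassP (u + t)) =ᶠ[𝓝 t]
          fun t => L.derivWeierstrassP (z + t) - L.derivWeierstrassP (u + t) := by
        filter_upwards [h1, h2] with s h3 h4
        exact (hd1 s h3 h4).deriv
      rw [e.deriv_eq, ((hD' z t h1.self_of_nhds).fun_sub (hD' u t h2.self_of_nhds)).deriv]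
      simp only [Pi.mul_apply]
      ring) (by simp [h]) (by rw [(hd1 0 hz0 hu0).deriv]; simp [h'])
  by_contra hzu
  -- The translates agree near `t = 0`, hence off the countable set `S`, whose complement is
  -- connected. As `t → -u` one of them has a pole, while the other stays finite if `z - u` is not a
  -- period.
  let S : Set ℂ := ((fun t => z + t) ⁻¹' L.lattice) ∪ ((fun t => u + t) ⁻¹' L.lattice)
  have hS : S.Countable :=
    (L.countable_lattice.preimage (add_right_injective z)).union
      (L.countable_lattice.preimage (add_right_injective u))
  have hSc : IsPreconnected Sᶜ := (hS.isConnected_compl_of_one_lt_rank (by simp)).isPreconnected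
  have hEq : Set.EqOn (fun t => L.weierstrassP (z + t)) (fun t => L.weierstrassP (u + t)) Sᶜ := by
    refine AnalyticOnNhd.eqOn_of_preconnected_of_eventuallyEq (z₀ := 0)
      (fun t ht => hA z t fun hh => ht (Or.inl hh)) (fun t ht => hA u t fun hh => ht (Or.inr hh)) hSc
      (by rintro (hh | hh) <;> simp_all) ?_
    filter_upwards [hev] with t ht
    exact sub_eq_zero.1 ht
  have hzu' : z + -u ∉ L.lattice := by rwa [← sub_eq_add_neg]
  have h3 : Tendsto (fun t => u + t) (𝓝[≠] (-u)) (𝓝[≠] 0) := by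
    refine tendsto_nhdsWithin_iff.2 ⟨?_, ?_⟩
    · have : Tendsto (fun t => u + t) (𝓝 (-u)) (𝓝 (u + -u)) := by
        exact (by fun_prop : Continuous fun t : ℂ => u + t).tendsto _
      rw [add_neg_cancel] at this
      exact this.mono_left nhdsWithin_le_nhds
    · filter_upwards [self_mem_nhdsWithin] with t ht hh
      exact ht (by simpa using (eq_neg_of_add_eq_zero_right hh))
  have hne : ∀ᶠ t in 𝓝[≠] (-u), t ∈ Sᶜ := by
    have h2 : ∀ᶠ t in 𝓝 (-u), z + t ∉ L.lattice :=
      (by fun_prop : ContinuousAt (fun t : ℂ => z + t) (-u)).eventually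
        (L.isOpen_compl_lattice.mem_nhds hzu')
    filter_upwards [h2.filter_mono nhdsWithin_le_nhds,
      h3.eventually (L.eventually_punctured_notMem_lattice 0)] with t ht ht'
    rintro (hh | hh)
    · exact ht hh
    · exact ht' hh
  have hlim1 : Tendsto (fun t => L.weierstrassP (u + t)) (𝓝[≠] (-u)) (Bornology.cobounded ℂ) :=
    (L.tendsto_weierstrassP_cobounded (zero_mem L.lattice)).comp h3
  have hlim2 : Tendsto (fun t => L.weierstrassP (u + t)) (𝓝[≠] (-u))
      (𝓝 (L.weierstrassP (z + -u))) := by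
    refine Tendsto.congr' ?_ ((hA z (-u) hzu').continuousAt.tendsto.mono_left nhdsWithin_le_nhds)
    filter_upwards [hne] with t ht
    exact hEq ht
  exact hlim2.not_tendsto (Metric.disjoint_nhds_cobounded _) hlim1

/-- If `℘'(z) = 0`, then `z` and `-z` give the same point of the cubic. -/
theorem two_mul_mem_lattice_of_derivWeierstrassP_eq_zero {z : ℂ} (hz : z ∉ L.lattice)
    (h : L.derivWeierstrassP z = 0) : 2 * z ∈ L.lattice := by
  have := L.sub_mem_lattice_of_weierstrassP_eq hz (u := -z) (by simpa using hz)
    (by rw [L.weierstrassP_neg]) (by rw [L.derivWeierstrassP_neg, h, neg_zero])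
  rwa [sub_neg_eq_add, ← two_mul] at this

/-- If `℘` omitted `c`, then `1/(℘ - c)`, extended by `0` to the lattice, would be entire and
periodic, hence bounded and constant by Liouville. But it vanishes exactly on the lattice. -/
theorem exists_weierstrassP_eq (c : ℂ) : ∃ z, z ∉ L.lattice ∧ L.weierstrassP z = c := by
  classical
  by_contra! H
  let h : ℂ → ℂ := fun z => if z ∈ L.lattice then 0 else (L.weierstrassP z - c)⁻¹
  have hne : ∀ z ∉ L.lattice, L.weierstrassP z - c ≠ 0 := fun z hz => sub_ne_zero.2 (H z hz)
  have hdiff : ∀ z ∉ L.lattice, DifferentiableAt ℂ h z := by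
    intro z hz
    refine DifferentiableAt.congr_of_eventuallyEq (f := fun z => (L.weierstrassP z - c)⁻¹) ?_ ?_
    · exact ((L.hasDerivAt_weierstrassP hz).differentiableAt.sub_const c).inv (hne z hz)
    · filter_upwards [L.isOpen_compl_lattice.mem_nhds hz] with t ht
      simp only [h, if_neg (show t ∉ L.lattice from ht)]
  have hD : Differentiable ℂ h := by
    intro z
    by_cases hz : z ∈ L.lattice
    · refine (Complex.analyticAt_of_differentiable_on_punctured_nhds_of_continuousAt
        (by filter_upwards [L.eventually_punctured_notMem_lattice z] with t ht using hdiff t ht)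
        ?_).differentiableAt
      rw [continuousAt_iff_punctured_nhds]
      have hz0 : h z = 0 := if_pos hz
      rw [hz0]
      have : Tendsto (fun z => (L.weierstrassP z - c)⁻¹) (𝓝[≠] z) (𝓝 0) := by
        refine tendsto_inv₀_cobounded.comp ?_
        have := L.tendsto_weierstrassP_cobounded hz
        rw [← tendsto_norm_atTop_iff_cobounded] at this ⊢
        refine tendsto_atTop_mono (fun t => ?_) (tendsto_atTop_add_const_right _ (-‖c‖) this)
        simpa [sub_eq_add_neg] using norm_sub_norm_le (L.weierstrassP t) c
      refine this.congr' ?_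
      filter_upwards [L.eventually_punctured_notMem_lattice z] with t ht
      simp only [h, if_neg ht]
    · exact hdiff z hz
  have hper : ∀ z w, w ∈ L.lattice → h (z + w) = h z := by
    intro z w hw
    have := L.weierstrassP_add_coe z ⟨w, hw⟩
    simp only at this
    simp only [h, this, L.lattice.add_mem_iff_left hw]
  obtain ⟨z, hz, -⟩ := L.exists_derivWeierstrassP_ne_zero
  have := hD.apply_eq_apply_of_bounded
    (IsZLattice.isCompact_range_of_periodic L.lattice h hD.continuous hper).isBounded z 0
  simp only [h, if_neg hz, if_pos (zero_mem L.lattice)] at this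
  exact inv_ne_zero (hne z hz) this

/-- Every affine point of the cubic is of the form `(℘(z), ℘'(z))`. -/
theorem exists_weierstrassP_eq_of_affineEq {x y : ℂ} (h : y ^ 2 = 4 * x ^ 3 - L.g₂ * x - L.g₃) :
    ∃ z, z ∉ L.lattice ∧ L.weierstrassP z = x ∧ L.derivWeierstrassP z = y := by
  obtain ⟨z, hz, rfl⟩ := L.exists_weierstrassP_eq x
  rw [← L.derivWeierstrassP_sq z hz] at h
  rcases sq_eq_sq_iff_eq_or_eq_neg.1 h with h | h
  · exact ⟨z, hz, rfl, h.symm⟩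
  · exact ⟨-z, by simpa using hz, L.weierstrassP_neg z, by rw [L.derivWeierstrassP_neg, h]⟩

end PeriodPair

/-! ### The projective plane is Hausdorff -/

section Hausdorff

/-- The Hermitian projector onto a line of `ℂ³`, as a function of a spanning vector. -/
def lineProjector (v : {v : Fin 3 → ℂ // v ≠ 0}) : Fin 3 → Fin 3 → ℂ := fun i j =>
  v.1 i * star (v.1 j) / ∑ k, v.1 k * star (v.1 k)

theorem sum_mul_star_ne_zero {v : Fin 3 → ℂ} (hv : v ≠ 0) : ∑ k, v k * star (v k) ≠ 0 := by
  have e : ∑ k, v k * star (v k) = ((∑ k, Complex.normSq (v k) : ℝ) : ℂ) := by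
    rw [Complex.ofReal_sum]
    exact Finset.sum_congr rfl fun k _ => Complex.mul_conj (v k)
  rw [e, Complex.ofReal_ne_zero]
  intro h
  rw [Finset.sum_eq_zero_iff_of_nonneg fun k _ => Complex.normSq_nonneg _] at h
  exact hv (funext fun k => Complex.normSq_eq_zero.1 (h k (Finset.mem_univ k)))

theorem continuous_lineProjector : Continuous lineProjector := by
  refine continuous_pi fun i => continuous_pi fun j => ?_
  have hc : ∀ k, Continuous fun v : {v : Fin 3 → ℂ // v ≠ 0} => v.1 k := fun k =>
    (continuous_apply k).comp continuous_subtype_val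
  refine ((hc i).mul (hc j).star).div (continuous_finsetSum _ fun k _ => (hc k).mul (hc k).star)
    fun v => sum_mul_star_ne_zero v.2

theorem lineProjector_smul (a b : {v : Fin 3 → ℂ // v ≠ 0}) (t : ℂ) (h : (a : Fin 3 → ℂ) = t • b.1) :
    lineProjector a = lineProjector b := by
  have ht : t ≠ 0 := by
    rintro rfl
    exact a.2 (by simpa using h)
  have ht' : star t ≠ 0 := star_ne_zero.2 ht
  ext i j
  simp only [lineProjector, h, Pi.smul_apply, smul_eq_mul, star_mul']
  have e : ∑ k, t * b.1 k * (star t * star (b.1 k)) = (t * star t) * ∑ k, b.1 k * star (b.1 k) := by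
    rw [Finset.mul_sum]
    exact Finset.sum_congr rfl fun k _ => by ring
  rw [e, show t * b.1 i * (star t * star (b.1 j)) = (t * star t) * (b.1 i * star (b.1 j)) by ring,
    mul_div_mul_left _ _ (mul_ne_zero ht ht')]

/-- The Hermitian projector onto a line determines the line and depends continuously on it, so the
plane injects continuously into a space of matrices. Hausdorffness is needed for compact images in
the cubic to be closed. -/
instance : T2Space (Projectivization ℂ (Fin 3 → ℂ)) := by
  let F : Projectivization ℂ (Fin 3 → ℂ) → Fin 3 → Fin 3 → ℂ :=
    Projectivization.lift lineProjector fun a b t h => lineProjector_smul a b t h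
  have hF : Continuous F := continuous_coinduced_dom.2 continuous_lineProjector
  refine T2Space.of_injective_continuous (f := F) (fun P Q h => ?_) hF
  induction P using Projectivization.ind with | h v hv =>
  induction Q using Projectivization.ind with | h w hw =>
  obtain ⟨j, hj⟩ := Function.ne_iff.1 hv
  have hvs := sum_mul_star_ne_zero hv
  have hws := sum_mul_star_ne_zero hw
  have h' : ∀ i, v i * star (v j) / ∑ k, v k * star (v k) =
      w i * star (w j) / ∑ k, w k * star (w k) := fun i => congrFun (congrFun h i) j
  have hj' : star (v j) ≠ 0 := star_ne_zero.2 hj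
  rw [Projectivization.mk_eq_mk_iff']
  refine ⟨(star (w j) / ∑ k, w k * star (w k)) * ((∑ k, v k * star (v k)) / star (v j)), ?_⟩
  ext i
  have := h' i
  simp only [Pi.smul_apply, smul_eq_mul]
  rw [div_eq_div_iff hvs hws] at this
  field_simp
  linear_combination -this

instance (C : WeierstrassCubic) : T2Space C.Points :=
  inferInstanceAs (T2Space {P : Projectivization ℂ (Fin 3 → ℂ) // C.HomogeneousEq P.rep})

end Hausdorff

/-! ### The cubic as the torus `ℂ / L`, including the point at infinity -/

/-- The point `[x : 1 : z]` of the projective plane. -/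
def nearInfinity (q : ℂ × ℂ) : Projectivization ℂ (Fin 3 → ℂ) :=
  Projectivization.mk ℂ ![q.1, 1, q.2] (fun h => by simpa using congrFun h 1)

theorem continuous_nearInfinity : Continuous nearInfinity := by
  have h : Continuous (fun q : ℂ × ℂ =>
      (⟨![q.1, 1, q.2], fun h => by simpa using congrFun h 1⟩ : {v : Fin 3 → ℂ // v ≠ 0})) := by
    refine Continuous.subtype_mk (continuous_pi fun i => ?_) _
    fin_cases i
    · exact continuous_fst
    · exact continuous_const
    · exact continuous_snd
  exact (continuous_coinduced_rng (f := fun v : {v : Fin 3 → ℂ // v ≠ 0} =>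
    Projectivization.mk ℂ v.1 v.2)).comp h

theorem affineToProjective_eq_nearInfinity {x y : ℂ} (hy : y ≠ 0) :
    affineToProjective (x, y) = nearInfinity (x / y, y⁻¹) := by
  unfold affineToProjective nearInfinity
  rw [Projectivization.mk_eq_mk_iff']
  refine ⟨y, ?_⟩
  ext i
  fin_cases i <;> simp [hy, mul_div_cancel₀]

theorem affineToProjective_injective : Function.Injective affineToProjective := by
  rintro ⟨x, y⟩ ⟨x', y'⟩ h
  unfold affineToProjective at h
  rw [Projectivization.mk_eq_mk_iff'] at h
  obtain ⟨a, ha⟩ := h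
  have h0 := congrFun ha 0
  have h1 := congrFun ha 1
  have h2 := congrFun ha 2
  simp at h0 h1 h2
  subst h2
  simp_all

theorem affineToProjective_ne_nearInfinity (q : ℂ × ℂ) (x : ℂ) :
    affineToProjective q ≠ nearInfinity (x, 0) := by
  intro h
  unfold affineToProjective nearInfinity at h
  rw [Projectivization.mk_eq_mk_iff'] at h
  obtain ⟨a, ha⟩ := h
  simpa using congrFun ha 2

namespace PeriodPair

open Filter Topology

variable (L : PeriodPair)

/-- The Weierstrass cubic with the invariants of the lattice. -/
def cubic : WeierstrassCubic := ⟨L.g₂, L.g₃⟩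

/-- Squares are used because they are rational in `s = 1/℘`, which tends to `0`. With `q = 4 - g₂s²
- g₃s³` one has `℘'² = ℘³q`, so the two squares are `s/q` and `s³/q`. -/
theorem tendsto_sq_div_derivWeierstrassP {l : ℂ} (hl : l ∈ L.lattice) :
    (∀ᶠ z in 𝓝[≠] l, L.derivWeierstrassP z ≠ 0) ∧
    Tendsto (fun z => (L.weierstrassP z / L.derivWeierstrassP z) ^ 2) (𝓝[≠] l) (𝓝 0) ∧
    Tendsto (fun z => ((L.derivWeierstrassP z)⁻¹) ^ 2) (𝓝[≠] l) (𝓝 0) := by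
  have hP := L.tendsto_weierstrassP_cobounded hl
  have hs : Tendsto (fun z => (L.weierstrassP z)⁻¹) (𝓝[≠] l) (𝓝 0) :=
    tendsto_inv₀_cobounded.comp hP
  have hne : ∀ᶠ z in 𝓝[≠] l, L.weierstrassP z ≠ 0 := hP.eventually_ne_cobounded 0
  have hq : Tendsto (fun z => 4 - L.g₂ * (L.weierstrassP z)⁻¹ ^ 2 - L.g₃ * (L.weierstrassP z)⁻¹ ^ 3)
      (𝓝[≠] l) (𝓝 4) := by
    simpa using (tendsto_const_nhds.sub ((hs.pow 2).const_mul L.g₂)).sub ((hs.pow 3).const_mul L.g₃)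
      (f := fun z => 4 - L.g₂ * (L.weierstrassP z)⁻¹ ^ 2)
  have hq0 := hq.eventually_ne (by norm_num : (4 : ℂ) ≠ 0)
  have hrel : ∀ᶠ z in 𝓝[≠] l, L.derivWeierstrassP z ^ 2 = L.weierstrassP z ^ 3 *
      (4 - L.g₂ * (L.weierstrassP z)⁻¹ ^ 2 - L.g₃ * (L.weierstrassP z)⁻¹ ^ 3) := by
    filter_upwards [hne, L.eventually_punctured_notMem_lattice l] with z h1 h2
    rw [L.derivWeierstrassP_sq z h2]
    field_simp
  refine ⟨?_, ?_, ?_⟩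
  · filter_upwards [hne, hq0, hrel] with z h1 h2 h3 h4
    rw [h4, zero_pow two_ne_zero] at h3
    exact mul_ne_zero (pow_ne_zero 3 h1) h2 h3.symm
  · have h0 : Tendsto (fun z => (L.weierstrassP z)⁻¹ /
        (4 - L.g₂ * (L.weierstrassP z)⁻¹ ^ 2 - L.g₃ * (L.weierstrassP z)⁻¹ ^ 3)) (𝓝[≠] l) (𝓝 0) := by
      have := hs.div hq (by norm_num)
      rw [zero_div] at this
      exact this
    refine h0.congr' ?_
    filter_upwards [hne, hq0, hrel] with z h1 h2 h3
    rw [div_pow, h3, div_eq_div_iff h2 (mul_ne_zero (pow_ne_zero 3 h1) h2), ← mul_assoc]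
    congr 1
    field_simp
  · have h0 : Tendsto (fun z => (L.weierstrassP z)⁻¹ ^ 3 /
        (4 - L.g₂ * (L.weierstrassP z)⁻¹ ^ 2 - L.g₃ * (L.weierstrassP z)⁻¹ ^ 3)) (𝓝[≠] l) (𝓝 0) := by
      have := (hs.pow 3).div hq (by norm_num)
      rw [zero_pow three_ne_zero, zero_div] at this
      exact this
    refine h0.congr' ?_
    filter_upwards [hne, hq0, hrel] with z h1 h2 h3
    rw [inv_pow (L.derivWeierstrassP z), h3, mul_inv, inv_pow, div_eq_mul_inv]

theorem tendsto_zero_of_sq {α : Type*} {F : Filter α} {f : α → ℂ}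
    (h : Tendsto (fun z => f z ^ 2) F (𝓝 0)) : Tendsto f F (𝓝 0) := by
  rw [tendsto_zero_iff_norm_tendsto_zero] at h ⊢
  have := (Real.continuous_sqrt.tendsto 0).comp h
  simpa [Function.comp_def, norm_pow, Real.sqrt_sq] using this

theorem affineEq_weierstrassP {z : ℂ} (hz : z ∉ L.lattice) :
    L.cubic.AffineEq (L.weierstrassP z) (L.derivWeierstrassP z) := L.derivWeierstrassP_sq z hz

theorem homogeneousEq_infinity : L.cubic.HomogeneousEq (nearInfinity (0, 0)).rep := by
  unfold nearInfinity
  rw [WeierstrassCubic.homogeneousEq_rep_mk]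
  simp [WeierstrassCubic.HomogeneousEq]

open Classical in
/-- The parametrization `z ↦ [℘(z) : ℘'(z) : 1]` of the projective cubic. -/
def param (z : ℂ) : L.cubic.Points :=
  if hz : z ∈ L.lattice then ⟨nearInfinity (0, 0), L.homogeneousEq_infinity⟩
  else ⟨affineToProjective (L.weierstrassP z, L.derivWeierstrassP z),
    L.cubic.homogeneousEq_affineToProjective (L.affineEq_weierstrassP hz)⟩

theorem param_of_mem {z : ℂ} (hz : z ∈ L.lattice) : (L.param z).1 = nearInfinity (0, 0) := by
  simp [param, hz]

theorem param_of_notMem {z : ℂ} (hz : z ∉ L.lattice) :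
    (L.param z).1 = affineToProjective (L.weierstrassP z, L.derivWeierstrassP z) := by
  simp [param, hz]

/-- At lattice points continuity is checked in the chart `[x/y : 1 : 1/y]`, where both coordinates
tend to `0`. -/
theorem continuous_param : Continuous L.param := by
  refine continuous_induced_rng.2 ?_
  change Continuous fun z => (L.param z).1
  rw [continuous_iff_continuousAt]
  intro z
  by_cases hz : z ∈ L.lattice
  · obtain ⟨h1, h2, h3⟩ := L.tendsto_sq_div_derivWeierstrassP hz
    have hc : Tendsto (fun z => nearInfinity (L.weierstrassP z / L.derivWeierstrassP z,
        (L.derivWeierstrassP z)⁻¹)) (𝓝[≠] z) (𝓝 (nearInfinity (0, 0))) :=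
      (continuous_nearInfinity.tendsto (0, 0)).comp
        ((tendsto_zero_of_sq h2).prodMk_nhds (tendsto_zero_of_sq h3))
    rw [continuousAt_iff_punctured_nhds, L.param_of_mem hz]
    refine hc.congr' ?_
    filter_upwards [h1, L.eventually_punctured_notMem_lattice z] with t ht ht'
    rw [L.param_of_notMem ht', affineToProjective_eq_nearInfinity ht]
  · have hc : ContinuousAt (fun z => affineToProjective (L.weierstrassP z, L.derivWeierstrassP z)) z :=
      continuous_affineToProjective.continuousAt.comp
        ((L.analyticOnNhd_weierstrassP z hz).continuousAt.prodMk
          (L.analyticOnNhd_derivWeierstrassP z hz).continuousAt)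
    refine hc.congr ?_
    filter_upwards [L.isOpen_compl_lattice.mem_nhds hz] with t ht
    exact (L.param_of_notMem ht).symm

theorem param_eq_iff {z u : ℂ} : L.param z = L.param u ↔ z - u ∈ L.lattice := by
  constructor
  · intro h
    have h' := congrArg Subtype.val h
    by_cases hz : z ∈ L.lattice <;> by_cases hu : u ∈ L.lattice
    · exact sub_mem hz hu
    · rw [L.param_of_mem hz, L.param_of_notMem hu] at h'
      exact absurd h'.symm (affineToProjective_ne_nearInfinity _ _)
    · rw [L.param_of_mem hu, L.param_of_notMem hz] at h'
      exact absurd h' (affineToProjective_ne_nearInfinity _ _)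
    · rw [L.param_of_notMem hz, L.param_of_notMem hu] at h'
      have := affineToProjective_injective h'
      rw [Prod.mk.injEq] at this
      exact L.sub_mem_lattice_of_weierstrassP_eq hz hu this.1 this.2
  · intro h
    obtain ⟨l, rfl⟩ : ∃ l : L.lattice, z = u + l := ⟨⟨z - u, h⟩, by simp⟩
    apply Subtype.ext
    by_cases hu : u ∈ L.lattice
    · rw [L.param_of_mem hu, L.param_of_mem (add_mem hu l.2)]
    · rw [L.param_of_notMem hu, L.param_of_notMem (by rwa [L.lattice.add_mem_iff_left l.2]),
        L.weierstrassP_add_coe, L.derivWeierstrassP_add_coe]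

theorem param_surjective : Function.Surjective L.param := by
  rintro ⟨P, hP⟩
  induction P using Projectivization.ind with | h v hv =>
  have hP' := (L.cubic.homogeneousEq_rep_mk v hv).1 hP
  unfold WeierstrassCubic.HomogeneousEq at hP'
  by_cases h2 : v 2 = 0
  · refine ⟨0, Subtype.ext ?_⟩
    rw [L.param_of_mem (zero_mem _)]
    have h0 : v 0 = 0 := by simpa [h2] using hP'
    have h1 : v 1 ≠ 0 := by
      intro h1
      refine hv (funext fun i => ?_)
      fin_cases i <;> simp [h0, h1, h2]
    unfold nearInfinity
    rw [Projectivization.mk_eq_mk_iff']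
    refine ⟨(v 1)⁻¹, funext fun i => ?_⟩
    fin_cases i <;> simp [h0, h1, h2]
  · obtain ⟨z, hz, hx, hy⟩ := L.exists_weierstrassP_eq_of_affineEq
      (x := v 0 / v 2) (y := v 1 / v 2) (by
        change _ = 4 * v 0 ^ 3 - L.g₂ * _ * _ - L.g₃ * _ at hP'
        field_simp
        linear_combination hP')
    refine ⟨z, Subtype.ext ?_⟩
    rw [L.param_of_notMem hz, hx, hy]
    unfold affineToProjective
    rw [Projectivization.mk_eq_mk_iff']
    refine ⟨(v 2)⁻¹, funext fun i => ?_⟩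
    fin_cases i <;> simp [h2, div_eq_inv_mul]

theorem coord_zero_lattice (m n : ℤ) : L.basis.coord 0 (m * L.ω₁ + n * L.ω₂) = m := by
  have h : (m * L.ω₁ + n * L.ω₂ : ℂ) = (m : ℝ) • L.basis 0 + (n : ℝ) • L.basis 1 := by simp
  rw [h, map_add, map_smul, map_smul, Module.Basis.coord_apply, Module.Basis.coord_apply,
    Module.Basis.repr_self, Module.Basis.repr_self]
  simp

theorem coord_one_lattice (m n : ℤ) : L.basis.coord 1 (m * L.ω₁ + n * L.ω₂) = n := by
  have h : (m * L.ω₁ + n * L.ω₂ : ℂ) = (m : ℝ) • L.basis 0 + (n : ℝ) • L.basis 1 := by simp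
  rw [h, map_add, map_smul, map_smul, Module.Basis.coord_apply, Module.Basis.coord_apply,
    Module.Basis.repr_self, Module.Basis.repr_self]
  simp

theorem exists_int_coord {z : ℂ} (hz : z ∈ L.lattice) (i : Fin 2) :
    ∃ m : ℤ, L.basis.coord i z = m := by
  obtain ⟨m, n, rfl⟩ := mem_lattice.1 hz
  fin_cases i
  · exact ⟨m, L.coord_zero_lattice m n⟩
  · exact ⟨n, L.coord_one_lattice m n⟩

theorem continuous_coord (i : Fin 2) : Continuous (L.basis.coord i) :=
  LinearMap.continuous_of_finiteDimensional _

/-- The first coordinate of the cubic, viewed as a real torus. -/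
def circleCoord : C(L.cubic.Points, AddCircle (1 : ℝ)) where
  toFun P := ((L.basis.coord 0 (Function.surjInv L.param_surjective P) : ℝ) : AddCircle (1 : ℝ))
  continuous_toFun := by
    set f : L.cubic.Points → AddCircle (1 : ℝ) := fun P =>
      ((L.basis.coord 0 (Function.surjInv L.param_surjective P) : ℝ) : AddCircle (1 : ℝ)) with hf
    have hfp : ∀ z, f (L.param z) = ((L.basis.coord 0 z : ℝ) : AddCircle (1 : ℝ)) := by
      intro z
      have h := (L.param_eq_iff).1 (Function.surjInv_eq L.param_surjective (L.param z))
      obtain ⟨m, hm⟩ := L.exists_int_coord h 0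
      rw [hf, ← sub_eq_zero]
      simp only
      rw [← AddCircle.coe_sub, ← map_sub, hm, AddCircle.coe_eq_zero_iff]
      exact ⟨m, by simp⟩
    have hcont : Continuous fun z => ((L.basis.coord 0 z : ℝ) : AddCircle (1 : ℝ)) :=
      (AddCircle.continuous_mk' 1).comp (L.continuous_coord 0)
    rw [continuous_iff_isClosed]
    intro F hF
    -- The preimage of `F` in the cubic is the image of the part of the compact fundamental
    -- parallelogram lying over `F`. It is therefore compact, hence closed.
    have hcpt : IsCompact ((parallelepiped L.basis) ∩
        (fun z => ((L.basis.coord 0 z : ℝ) : AddCircle (1 : ℝ))) ⁻¹' F) :=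
      L.basis.parallelepiped.isCompact.inter_right (hF.preimage hcont)
    have := (hcpt.image L.continuous_param).isClosed
    convert this
    ext P
    constructor
    · intro hP
      obtain ⟨z, rfl⟩ := L.param_surjective P
      -- Subtracting the integer parts of the coordinates moves `z` into the fundamental
      -- parallelogram.
      let l : ℂ := ⌊L.basis.coord 0 z⌋ * L.ω₁ + ⌊L.basis.coord 1 z⌋ * L.ω₂
      have hl : l ∈ L.lattice := mem_lattice.2 ⟨_, _, rfl⟩
      have hp : L.param (z - l) = L.param z := by
        rw [L.param_eq_iff]
        simpa using hl
      refine ⟨z - l, ⟨?_, ?_⟩, hp⟩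
      · rw [parallelepiped_basis_eq]
        intro i
        have h0 := L.coord_zero_lattice ⌊L.basis.coord 0 z⌋ ⌊L.basis.coord 1 z⌋
        have h1 := L.coord_one_lattice ⌊L.basis.coord 0 z⌋ ⌊L.basis.coord 1 z⌋
        fin_cases i
        · change L.basis.coord 0 (z - l) ∈ _
          rw [map_sub, h0]
          exact ⟨Int.fract_nonneg _, (Int.fract_lt_one _).le⟩
        · change L.basis.coord 1 (z - l) ∈ _
          rw [map_sub, h1]
          exact ⟨Int.fract_nonneg _, (Int.fract_lt_one _).le⟩
      · change f (L.param z) ∈ F at hP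
        rw [← hp, hfp] at hP
        exact hP
    · rintro ⟨z, ⟨-, hz⟩, rfl⟩
      change f (L.param z) ∈ F
      rw [hfp]
      exact hz

theorem circleCoord_param (z : ℂ) :
    L.circleCoord (L.param z) = ((L.basis.coord 0 z : ℝ) : AddCircle (1 : ℝ)) := by
  have h := (L.param_eq_iff).1 (Function.surjInv_eq L.param_surjective (L.param z))
  obtain ⟨m, hm⟩ := L.exists_int_coord h 0
  change ((L.basis.coord 0 (Function.surjInv L.param_surjective _) : ℝ) : AddCircle (1 : ℝ)) = _
  rw [← sub_eq_zero, ← AddCircle.coe_sub, ← map_sub, hm, AddCircle.coe_eq_zero_iff]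
  exact ⟨m, by simp⟩

end PeriodPair

/-! ### A primitive loop with period `ω₁` -/

namespace PeriodPair

variable (L : PeriodPair)

/-- The segment `t ↦ ω₂ / 3 + t ω₁`, which projects to a closed curve on the torus. -/
def periodSegment (t : ℝ) : ℂ := L.ω₂ / 3 + t * L.ω₁

theorem coord_zero_periodSegment (t : ℝ) : L.basis.coord 0 (L.periodSegment t) = t := by
  have h : L.periodSegment t = t • L.basis 0 + (3 : ℝ)⁻¹ • L.basis 1 := by
    simp [periodSegment]; ring
  rw [h, map_add, map_smul, map_smul, Module.Basis.coord_apply, Module.Basis.coord_apply,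
    Module.Basis.repr_self, Module.Basis.repr_self]
  simp

theorem coord_one_periodSegment (t : ℝ) : L.basis.coord 1 (L.periodSegment t) = 3⁻¹ := by
  have h : L.periodSegment t = t • L.basis 0 + (3 : ℝ)⁻¹ • L.basis 1 := by
    simp [periodSegment]; ring
  rw [h, map_add, map_smul, map_smul, Module.Basis.coord_apply, Module.Basis.coord_apply,
    Module.Basis.repr_self, Module.Basis.repr_self]
  simp

/-- The offset `ω₂ / 3` serves here and in the next lemma: neither `1/3` nor `2/3` is an integer, so
the loop avoids the point at infinity and the points with `y = 0`. -/
theorem periodSegment_notMem_lattice (t : ℝ) : L.periodSegment t ∉ L.lattice := by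
  intro h
  obtain ⟨m, hm⟩ := L.exists_int_coord h 1
  rw [coord_one_periodSegment] at hm
  have h3 : ((3 * m : ℤ) : ℝ) = (1 : ℤ) := by
    push_cast
    rw [← hm]
    norm_num
  have := Int.cast_injective h3
  omega

theorem derivWeierstrassP_periodSegment_ne_zero (t : ℝ) :
    L.derivWeierstrassP (L.periodSegment t) ≠ 0 := by
  intro h
  obtain ⟨m, hm⟩ := L.exists_int_coord
    (L.two_mul_mem_lattice_of_derivWeierstrassP_eq_zero (L.periodSegment_notMem_lattice t) h) 1
  rw [two_mul, map_add, coord_one_periodSegment] at hm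
  have h3 : ((3 * m : ℤ) : ℝ) = (2 : ℤ) := by
    push_cast
    rw [← hm]
    norm_num
  have := Int.cast_injective h3
  omega

theorem hasDerivAt_periodSegment (t : ℝ) : HasDerivAt L.periodSegment L.ω₁ t := by
  have h := ((Complex.ofRealCLM.hasDerivAt (x := t)).mul_const L.ω₁).const_add (L.ω₂ / 3)
  rw [Complex.ofRealCLM_apply, Complex.ofReal_one, one_mul] at h
  exact h

theorem contDiff_periodSegment : ContDiff ℝ 1 L.periodSegment :=
  contDiff_const.add (Complex.ofRealCLM.contDiff.mul contDiff_const)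

theorem contDiff_comp_periodSegment {f : ℂ → ℂ} (hf : AnalyticOnNhd ℂ f (L.lattice : Set ℂ)ᶜ) :
    ContDiff ℝ 1 fun t => f (L.periodSegment t) := by
  rw [contDiff_iff_contDiffAt]
  intro t
  exact ((hf _ (L.periodSegment_notMem_lattice t)).contDiffAt.restrict_scalars ℝ).comp t
    L.contDiff_periodSegment.contDiffAt

theorem periodSegment_one : L.periodSegment 1 = L.periodSegment 0 + L.ω₁ := by
  simp [periodSegment]

/-- The closed curve on the cubic given by `t ↦ ω₂ / 3 + t ω₁`. -/
def periodLoop : L.cubic.AffineLoop where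
  x t := L.weierstrassP (L.periodSegment t)
  y t := L.derivWeierstrassP (L.periodSegment t)
  contDiff_x := L.contDiff_comp_periodSegment L.analyticOnNhd_weierstrassP
  contDiff_y := L.contDiff_comp_periodSegment L.analyticOnNhd_derivWeierstrassP
  mem t _ := L.affineEq_weierstrassP (L.periodSegment_notMem_lattice t)
  x_closed := by
    rw [periodSegment_one]
    exact (L.weierstrassP_add_coe _ ⟨L.ω₁, L.ω₁_mem_lattice⟩).symm
  y_closed := by
    rw [periodSegment_one]
    exact (L.derivWeierstrassP_add_coe _ ⟨L.ω₁, L.ω₁_mem_lattice⟩).symm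

/-- The form `dx/y` pulls back to `℘' dz / ℘' = dz`, so the integrand is the constant `ω₁`. -/
theorem integral_periodLoop : L.periodLoop.integral = L.ω₁ := by
  have h : ∀ t : ℝ, deriv L.periodLoop.x t / L.periodLoop.y t = L.ω₁ := by
    intro t
    have hd := (L.hasDerivAt_weierstrassP (L.periodSegment_notMem_lattice t)).comp_of_eq t
      (L.hasDerivAt_periodSegment t) rfl
    rw [show deriv L.periodLoop.x t = _ from hd.deriv]
    exact mul_div_cancel_left₀ _ (L.derivWeierstrassP_periodSegment_ne_zero t)
  have hy : ∀ t : ℝ, L.periodLoop.y t ≠ 0 := L.derivWeierstrassP_periodSegment_ne_zero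
  simp [WeierstrassCubic.AffineLoop.integral, hy, h]

theorem simplex_periodLoop (p : stdSimplex ℝ (Fin 2)) :
    L.periodLoop.simplex p = L.param (L.periodSegment (p.1 1)) :=
  Subtype.ext (L.param_of_notMem (L.periodSegment_notMem_lattice _)).symm

theorem simplex_vertex_zero_eq : L.periodLoop.simplex (stdSimplex.vertex 0) =
    L.periodLoop.simplex (stdSimplex.vertex 1) := by
  rw [simplex_periodLoop, simplex_periodLoop, L.param_eq_iff]
  simp [periodSegment, L.ω₁_mem_lattice]

/-- The parameter `t` itself lifts the circle coordinate along the loop. The corrections by the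
section cancel because the ends coincide. -/
theorem winding_periodLoop : winding L.circleCoord L.periodLoop.simplex = 1 := by
  have hc : Continuous fun p : stdSimplex ℝ (Fin 2) => p.1 1 :=
    (continuous_apply 1).comp continuous_subtype_val
  have h := winding_eq L.circleCoord L.periodLoop.simplex ⟨fun p => p.1 1, hc⟩ (fun p => by
    rw [simplex_periodLoop, circleCoord_param, coord_zero_periodSegment]
    rfl)
  rw [L.simplex_vertex_zero_eq] at h
  have h' : (winding L.circleCoord L.periodLoop.simplex : ℝ) = (1 : ℤ) := by
    rw [h]
    simp [stdSimplex.vertex]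
  exact_mod_cast h'

theorem exists_primitive_hasPeriod :
    ∃ γ : L.cubic.H₁, IsPrimitiveElement γ ∧ L.cubic.HasPeriod γ L.ω₁ := by
  obtain ⟨z, hz⟩ := exists_cycle_of_loop L.periodLoop.simplex L.simplex_vertex_zero_eq
  exact ⟨_, isPrimitiveElement_of_winding_eq_one L.circleCoord L.periodLoop.simplex z hz
    L.winding_periodLoop, L.periodLoop, ⟨z, hz, rfl⟩, L.integral_periodLoop⟩

end PeriodPair

/-! ### Ramanujan's differential equations for `E₂`, `E₄`, `E₆` -/

section Ramanujan

open UpperHalfPlane hiding I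
open Complex ModularForm EisensteinSeries Filter Topology Derivative
open scoped Manifold MatrixGroups Real

local notation "𝕢" => Function.Periodic.qParam

theorem differentiableAt_comp_ofComplex {f : ℍ → ℂ} (hf : MDiff f) (τ : ℍ) :
    DifferentiableAt ℂ (f ∘ ofComplex) τ :=
  UpperHalfPlane.mdifferentiableAt_iff.mp (hf τ)

theorem hasDerivAt_qParam_one (z : ℂ) : HasDerivAt (𝕢 1) (2 * π * I * 𝕢 1 z) z := by
  have h : HasDerivAt (fun z : ℂ => cexp (2 * π * I * z / (1 : ℝ)))
      (cexp (2 * π * I * z / (1 : ℝ)) * (2 * π * I * 1 / (1 : ℝ))) z :=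
    (((hasDerivAt_id z).const_mul (2 * π * I)).div_const _).cexp
  convert! h using 1
  simp [Function.Periodic.qParam, mul_comm]

/-- In the coordinate `q`, the normalized derivative is `q d/dq`. -/
theorem normalizedDerivOfComplex_eq_cuspFunction {f : ℍ → ℂ}
    (hper : Function.Periodic (f ∘ ofComplex) (1 : ℝ)) (hf : MDiff f) (hb : IsBoundedAtImInfty f)
    (τ : ℍ) : normalizedDerivOfComplex f τ = 𝕢 1 τ * deriv (cuspFunction 1 f) (𝕢 1 τ) := by
  have hq : ‖𝕢 1 (τ : ℂ)‖ < 1 := Function.Periodic.norm_qParam_lt_one one_pos τ.im_pos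
  have hc := (differentiableAt_cuspFunction one_pos hper hf hb hq).hasDerivAt.comp (τ : ℂ)
    (hasDerivAt_qParam_one τ)
  have he : cuspFunction 1 f ∘ 𝕢 1 = f ∘ ofComplex := by
    ext z
    exact Function.Periodic.eq_cuspFunction one_ne_zero hper z
  rw [he] at hc
  rw [normalizedDerivOfComplex, hc.deriv]
  field_simp [two_pi_I_ne_zero]

/-- The derivation is `q d/dq`, and its factor `q` vanishes at the cusp. -/
theorem tendsto_normalizedDerivOfComplex {f : ℍ → ℂ}
    (hper : Function.Periodic (f ∘ ofComplex) (1 : ℝ)) (hf : MDiff f) (hb : IsBoundedAtImInfty f) :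
    Tendsto (normalizedDerivOfComplex f) atImInfty (𝓝 0) := by
  have hq := qParam_tendsto_atImInfty one_pos
  have ha := (analyticAt_cuspFunction_zero one_pos hper hf hb).deriv.continuousAt.tendsto.comp hq
  have := hq.mul ha
  rw [zero_mul] at this
  exact this.congr fun τ => (normalizedDerivOfComplex_eq_cuspFunction hper hf hb τ).symm

/-- A modular form of level one and weight less than `12` which vanishes at `i∞` is zero. -/
theorem eq_zero_of_slash_invariant {k : ℕ} (hk : k < 12) {f : ℍ → ℂ} (hf : MDiff f)
    (hs : ∀ γ : SL(2, ℤ), f ∣[(k : ℤ)] γ = f) (h0 : Tendsto f atImInfty (𝓝 0)) : f = 0 := by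
  let F : ModularForm 𝒮ℒ k :=
    { toFun := f
      slash_action_eq' := fun _ ⟨γ, hγ⟩ ↦ hγ ▸ hs γ
      holo' := hf
      bdd_at_cusps' := fun {c} hc => by
        rw [Subgroup.IsArithmetic.isCusp_iff_isCusp_SL2Z] at hc
        rw [OnePoint.isBoundedAt_iff_forall_SL2Z hc]
        intro γ _
        rw [hs]
        exact h0.isBigO_one ℝ }
  have hc : (qExpansion 1 F).coeff 0 = 0 := by
    rw [UpperHalfPlane.qExpansion_coeff_zero one_pos
      (ModularFormClass.analyticAt_cuspFunction_zero F one_pos one_mem_strictPeriods_SL)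
      (SlashInvariantFormClass.periodic_comp_ofComplex F one_mem_strictPeriods_SL)]
    exact h0.limUnder_eq
  -- For weight below `12` the Sturm bound is `0`, so vanishing of the constant coefficient
  -- suffices.
  have : F = 0 := ModularForm.sturm_bound_levelOne_nat (by
    rw [Nat.div_eq_of_lt hk]
    refine lt_of_lt_of_le (by norm_num : ((0 : ℕ) : ℕ∞) < 1) (PowerSeries.le_order _ _ fun i hi => ?_)
    obtain rfl : i = 0 := by
      have : i < 1 := by exact_mod_cast hi
      omega
    exact hc)
  exact congrArg DFunLike.coe this

theorem tendsto_atImInfty_of_modularForm {k : ℤ} (f : ModularForm 𝒮ℒ k) :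
    Tendsto f atImInfty (𝓝 ((qExpansion 1 f).coeff 0)) := by
  have hper := SlashInvariantFormClass.periodic_comp_ofComplex f one_mem_strictPeriods_SL
  have ha := ModularFormClass.analyticAt_cuspFunction_zero f one_pos one_mem_strictPeriods_SL
  have := ha.continuousAt.tendsto.comp (qParam_tendsto_atImInfty one_pos)
  have e : (qExpansion 1 f).coeff 0 = cuspFunction 1 f 0 := by
    simp [qExpansion_coeff]
  rw [e]
  exact this.congr fun τ => eq_cuspFunction τ one_ne_zero hper

theorem tendsto_E₄ : Tendsto E₄ atImInfty (𝓝 1) := by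
  have := tendsto_atImInfty_of_modularForm E₄
  rwa [E_qExpansion_coeff_zero _ ⟨2, rfl⟩] at this

theorem tendsto_E₆ : Tendsto E₆ atImInfty (𝓝 1) := by
  have := tendsto_atImInfty_of_modularForm E₆
  rwa [E_qExpansion_coeff_zero _ ⟨3, rfl⟩] at this

theorem slash_modularForm {k : ℤ} (f : ModularForm 𝒮ℒ k) (γ : SL(2, ℤ)) : ⇑f ∣[k] γ = f :=
  SlashInvariantForm.slash_action_eqn f _ ⟨γ, rfl⟩

theorem hasSum_E₂ (τ : ℍ) :
    HasSum (fun m : ℕ ↦ (if m = 0 then 1 else -24 * ArithmeticFunction.sigma 1 m : ℂ) •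
      𝕢 1 (τ : ℂ) ^ m) (E2 τ) := by
  simpa only [Function.Periodic.qParam, ofReal_one, div_one] using hasSum_qExpansion_E2 (z := τ)

/-- `E₂` is not a modular form, so periodicity is read off its `q`-expansion. Off the upper half
plane `ofComplex` is constant. -/
theorem periodic_E₂ : Function.Periodic (E2 ∘ ofComplex) (1 : ℝ) := by
  intro w
  by_cases! hw : 0 < w.im
  · have hw' : 0 < (w + (1 : ℝ)).im := by simpa using hw
    simp only [Function.comp_apply, ofComplex_apply_of_im_pos hw, ofComplex_apply_of_im_pos hw']
    have h := hasSum_E₂ ⟨w, hw⟩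
    have h' := hasSum_E₂ ⟨w + (1 : ℝ), hw'⟩
    have e : 𝕢 1 (w + (1 : ℝ)) = 𝕢 1 w := by
      simp only [Function.Periodic.qParam, ofReal_one, div_one, mul_add, mul_one]
      exact Complex.exp_periodic _
    simp only [e] at h h'
    exact h'.unique h
  · have hw' : (w + (1 : ℝ)).im ≤ 0 := by simpa using hw
    simp only [Function.comp_apply, ofComplex_apply_of_im_nonpos hw',
      ofComplex_apply_of_im_nonpos hw]

theorem tendsto_E₂ : Tendsto E2 atImInfty (𝓝 1) := by
  have ha := analyticAt_cuspFunction_zero one_pos periodic_E₂ E2_mdifferentiable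
    isBoundedAtImInfty_E2
  have h0 := (hasFPowerSeriesOnBall_cuspFunction one_pos ha hasSum_E₂).coeff_zero ![]
  have := ha.continuousAt.tendsto.comp (qParam_tendsto_atImInfty one_pos)
  rw [← h0] at this
  simp [FormalMultilinearSeries.ofScalars] at this
  exact this.congr fun τ => eq_cuspFunction τ one_ne_zero periodic_E₂

theorem E₂_slash (γ : SL(2, ℤ)) :
    E2 ∣[(2 : ℤ)] γ = E2 + fun z : ℍ => 12 * (2 * π * I)⁻¹ * (γ 1 0 / denom γ z) := by
  rw [E2_slash_action]
  ext z
  simp only [Pi.sub_apply, Pi.smul_apply, Pi.add_apply, D2, riemannZeta_two, smul_eq_mul]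
  have : (π : ℂ) ≠ 0 := by simp [Real.pi_ne_zero]
  generalize (denom γ z : ℂ) = d
  have hI : (I : ℂ)⁻¹ = -I := Complex.inv_I
  rw [mul_inv, hI]
  field_simp
  ring

/-- The Serre derivative `D E₄ - E₂E₄/3` is modular of weight `6` and has limit `-1/3` at the cusp.
Adding `E₆/3` gives a form of weight below `12` vanishing there. -/
theorem normalizedDerivOfComplex_E₄ :
    normalizedDerivOfComplex E₄ = fun z => (E2 z * E₄ z - E₆ z) / 3 := by
  have h4 : MDiff E₄ := E₄.holo'
  have h6 : MDiff E₆ := E₆.holo'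
  have h := eq_zero_of_slash_invariant (k := 6) (by norm_num)
    (f := serreDerivative (4 : ℤ) E₄ + (3⁻¹ : ℂ) • ⇑E₆)
    ((serreDerivative_mdifferentiable _ h4).add (h6.const_smul _)) (fun γ => by
      rw [SlashAction.add_slash, SL_smul_slash]
      exact congrArg₂ _ (serreDerivative_slash_invariant h4 (slash_modularForm E₄ γ))
        (congrArg _ (slash_modularForm E₆ γ))) (by
      have hs := (tendsto_normalizedDerivOfComplex
        (SlashInvariantFormClass.periodic_comp_ofComplex E₄ one_mem_strictPeriods_SL) h4
        (ModularFormClass.bdd_at_infty E₄)).sub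
        ((tendsto_E₂.const_mul ((4 : ℤ) * 12⁻¹ : ℂ)).mul tendsto_E₄)
      convert! hs.add (tendsto_E₆.const_smul (3⁻¹ : ℂ)) using 2
      norm_num)
  ext z
  have := congrFun h z
  simp at this
  linear_combination this

/-- The same argument in weight `8`, with `E₄²/2` cancelling the limit `-1/2`. -/
theorem normalizedDerivOfComplex_E₆ :
    normalizedDerivOfComplex E₆ = fun z => (E2 z * E₆ z - E₄ z ^ 2) / 2 := by
  have h4 : MDiff E₄ := E₄.holo'
  have h6 : MDiff E₆ := E₆.holo'
  have h := eq_zero_of_slash_invariant (k := 8) (by norm_num)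
    (f := serreDerivative (6 : ℤ) E₆ + (2⁻¹ : ℂ) • (⇑E₄ * ⇑E₄))
    ((serreDerivative_mdifferentiable _ h6).add ((h4.mul h4).const_smul _)) (fun γ => by
      rw [SlashAction.add_slash, SL_smul_slash]
      refine congrArg₂ _ (serreDerivative_slash_invariant h6 (slash_modularForm E₆ γ))
        (congrArg _ ?_)
      have := mul_slash_SL2 4 4 γ E₄ E₄
      rw [slash_modularForm] at this
      exact this) (by
      have hs := (tendsto_normalizedDerivOfComplex
        (SlashInvariantFormClass.periodic_comp_ofComplex E₆ one_mem_strictPeriods_SL) h6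
        (ModularFormClass.bdd_at_infty E₆)).sub
        ((tendsto_E₂.const_mul ((6 : ℤ) * 12⁻¹ : ℂ)).mul tendsto_E₆)
      convert! hs.add ((tendsto_E₄.mul tendsto_E₄).const_smul (2⁻¹ : ℂ)) using 2
      norm_num)
  ext z
  have := congrFun h z
  simp at this
  linear_combination this

/-- Since `E₂` is only quasimodular, the invariance of `D E₂ - E₂²/12` in weight `4` is checked by
hand: the anomalies of the derivative and of the square cancel. Adding `E₄/12` makes the limit at
the cusp zero. -/
theorem normalizedDerivOfComplex_E₂ :
    normalizedDerivOfComplex E2 = fun z => (E2 z ^ 2 - E₄ z) / 12 := by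
  have h4 : MDiff E₄ := E₄.holo'
  have h2 : MDiff E2 := E2_mdifferentiable
  have hslash : ∀ γ : SL(2, ℤ), (normalizedDerivOfComplex E2 + ((12⁻¹ : ℂ) • ⇑E₄ +
      (-12⁻¹ : ℂ) • (E2 * E2))) ∣[(4 : ℤ)] γ =
      normalizedDerivOfComplex E2 + ((12⁻¹ : ℂ) • ⇑E₄ + (-12⁻¹ : ℂ) • (E2 * E2)) := by
    intro γ
    have h4s := slash_modularForm E₄ γ
    have h2s := E₂_slash γ
    have hm : (E2 * E2) ∣[(4 : ℤ)] γ = _ := mul_slash_SL2 2 2 γ E2 E2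
    have hd := normalizedDerivOfComplex_SL_slash (k := 2) h2 (γ := γ)
    -- The extra term comes from the derivative of the anomaly, through `(c/(cz+d))' =
    -- -(c/(cz+d))²`.
    have hD : ∀ z : ℍ, normalizedDerivOfComplex (E2 ∣[(2 : ℤ)] γ) z =
        normalizedDerivOfComplex E2 z +
          (2 * π * I)⁻¹ * (12 * (2 * π * I)⁻¹ * -((γ 1 0 : ℂ) / denom γ z) ^ 2) := by
      intro z
      have hu : HasDerivAt (fun w : ℂ => 12 * (2 * π * I)⁻¹ * ((γ 1 0 : ℂ) / denom γ w))
          (12 * (2 * π * I)⁻¹ * -((γ 1 0 : ℂ) / denom γ z) ^ 2) z := by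
        have hz := denom_ne_zero γ z
        have h1 : HasDerivAt (fun w : ℂ => denom γ w) (γ 1 0 : ℂ) z := by
          have := ((hasDerivAt_id (z : ℂ)).const_mul (γ 1 0 : ℂ)).add_const (γ 1 1 : ℂ)
          convert! this using 1
          simp
        have h2 := ((hasDerivAt_const (z : ℂ) (γ 1 0 : ℂ)).div h1 hz).const_mul
          (12 * (2 * π * I)⁻¹ : ℂ)
        convert! h2 using 1
        field_simp
        ring
      have hE := (differentiableAt_comp_ofComplex h2 z).hasDerivAt.add hu
      have he : (E2 ∣[(2 : ℤ)] γ) ∘ ofComplex =ᶠ[𝓝 (z : ℂ)] (E2 ∘ ofComplex) +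
          fun w : ℂ => 12 * (2 * π * I)⁻¹ * ((γ 1 0 : ℂ) / denom γ w) := by
        filter_upwards [isOpen_upperHalfPlaneSet.mem_nhds z.im_pos] with w hw
        rw [h2s]
        simp [ofComplex_apply_of_im_pos hw]
      rw [normalizedDerivOfComplex, (hE.congr_of_eventuallyEq he).deriv, mul_add]
      rfl
    rw [SlashAction.add_slash, SlashAction.add_slash, SL_smul_slash, SL_smul_slash, h4s]
    ext z
    have hdz := congrFun hd z
    rw [hD z, Pi.sub_apply, h2s] at hdz
    rw [hm, h2s]
    simp only [Pi.add_apply, Pi.smul_apply, Pi.mul_apply, smul_eq_mul] at hdz ⊢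
    norm_num at hdz ⊢
    linear_combination -hdz
  have h := eq_zero_of_slash_invariant (k := 4) (by norm_num)
    ((normalizedDerivOfComplex_mdifferentiable h2).add
      ((h4.const_smul _).add ((h2.mul h2).const_smul _))) hslash (by
      have hs := tendsto_normalizedDerivOfComplex periodic_E₂ h2 isBoundedAtImInfty_E2
      convert! hs.add ((tendsto_E₄.const_smul (12⁻¹ : ℂ)).add
        ((tendsto_E₂.mul tendsto_E₂).const_smul (-12⁻¹ : ℂ))) using 2
      norm_num)
  ext z
  have := congrFun h z
  simp at this
  linear_combination this

end Ramanujan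

/-! ### The hypergeometric equation at the origin -/

section Hypergeometric

open Filter Topology

/-- In Leibniz's formula only the term with one derivative on `w` survives at `0`. For `n = 0` the
truncated `n - 1` is harmless, its factor being zero. -/
theorem iteratedDeriv_id_mul_zero {F : ℂ → ℂ} (hF : AnalyticAt ℂ F 0) (n : ℕ) :
    iteratedDeriv n (fun w => w * F w) 0 = n * iteratedDeriv (n - 1) F 0 := by
  have h := iteratedDeriv_fun_mul (n := n) (x := (0 : ℂ)) (f := fun w : ℂ => w) (g := F)
    contDiffAt_id hF.contDiffAt
  rw [h]
  rcases n with _ | n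
  · simp
  · rw [Finset.sum_eq_single 1]
    · simp [iteratedDeriv_one]
    · intro i _ hi
      rcases i with _ | _ | i
      · simp
      · exact absurd rfl hi
      · have : iteratedDeriv (i + 1 + 1) (fun w : ℂ => w) (0 : ℂ) = 0 := by
          rw [iteratedDeriv_succ', show deriv (fun w : ℂ => w) = fun _ => 1 from deriv_id'']
          simp [iteratedDeriv_const]
        simp [this]
    · simp

theorem iteratedDeriv_id_mul_deriv_zero {F : ℂ → ℂ} (hF : AnalyticAt ℂ F 0) (n : ℕ) :
    iteratedDeriv n (fun w => w * deriv F w) 0 = n * iteratedDeriv n F 0 := by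
  rw [iteratedDeriv_id_mul_zero hF.deriv]
  rcases n with _ | n
  · simp
  · rw [iteratedDeriv_succ', Nat.add_sub_cancel]

theorem hasFPowerSeriesAt_ordinaryHypergeometric {a b c : ℂ}
    (habc : ∀ n : ℕ, (n : ℂ) ≠ -a ∧ (n : ℂ) ≠ -b ∧ (n : ℂ) ≠ -c) :
    HasFPowerSeriesOnBall (ordinaryHypergeometric a b c : ℂ → ℂ)
      (ordinaryHypergeometricSeries ℂ a b c) 0 1 := by
  have h := ordinaryHypergeometricSeries_radius_eq_one ℂ a b c habc
  rw [← h]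
  exact (ordinaryHypergeometricSeries ℂ a b c).hasFPowerSeriesOnBall (by rw [h]; norm_num)

/-- A holomorphic solution of the hypergeometric differential equation at the origin is the
hypergeometric series. -/
theorem eventuallyEq_ordinaryHypergeometric {a b : ℂ}
    (hab : ∀ n : ℕ, (n : ℂ) ≠ -a ∧ (n : ℂ) ≠ -b ∧ (n : ℂ) ≠ -1) {g g₁ g₂ : ℂ → ℂ}
    (hg : AnalyticAt ℂ g 0) (h0 : g 0 = 1) (hg₁ : g₁ =ᶠ[𝓝 0] fun w => w * deriv g w)
    (hg₂ : g₂ =ᶠ[𝓝 0] fun w => w * deriv g₁ w)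
    (h : ∀ᶠ w in 𝓝 (0 : ℂ), g₂ w = w * (g₂ w + (a + b) * g₁ w + a * b * g w)) :
    g =ᶠ[𝓝 0] (ordinaryHypergeometric a b 1 : ℂ → ℂ) := by
  have ha₁ : AnalyticAt ℂ g₁ 0 := (analyticAt_id.mul hg.deriv).congr hg₁.symm
  have ha₂ : AnalyticAt ℂ g₂ 0 := (analyticAt_id.mul ha₁.deriv).congr hg₂.symm
  have e₁ : ∀ n, iteratedDeriv n g₁ 0 = n * iteratedDeriv n g 0 := fun n => by
    rw [← iteratedDeriv_id_mul_deriv_zero hg, hg₁.iteratedDeriv_eq]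
  have e₂ : ∀ n, iteratedDeriv n g₂ 0 = n * (n * iteratedDeriv n g 0) := fun n => by
    rw [← e₁, ← iteratedDeriv_id_mul_deriv_zero ha₁, hg₂.iteratedDeriv_eq]
  -- With `θ = w d/dw` the equation is `θ²g = w(θ + a)(θ + b)g`. On the `n`-th derivative at `0`,
  -- `θ` acts as multiplication by `n`, so comparing order `n + 1` gives the recursion.
  have hrec : ∀ n : ℕ, ((n : ℂ) + 1) * iteratedDeriv (n + 1) g 0 =
      (a + n) * (b + n) * iteratedDeriv n g 0 := by
    intro n
    have h1 : g₂ =ᶠ[𝓝 0] fun w => w * (g₂ w + (a + b) * g₁ w + a * b * g w) := h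
    have h2 := h1.iteratedDeriv_eq (n + 1)
    rw [iteratedDeriv_id_mul_zero (F := fun w => g₂ w + (a + b) * g₁ w + a * b * g w)
      ((ha₂.add (analyticAt_const.mul ha₁)).add (analyticAt_const.mul hg)), e₂,
      Nat.add_sub_cancel] at h2
    have h3 : iteratedDeriv n (fun w => g₂ w + (a + b) * g₁ w + a * b * g w) 0 =
        iteratedDeriv n g₂ 0 + (a + b) * iteratedDeriv n g₁ 0 + a * b * iteratedDeriv n g 0 := by
      rw [iteratedDeriv_fun_add, iteratedDeriv_fun_add, iteratedDeriv_const_mul_field,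
        iteratedDeriv_const_mul_field]
      · exact ha₂.contDiffAt
      · exact (analyticAt_const.mul ha₁).contDiffAt
      · exact (ha₂.add (analyticAt_const.mul ha₁)).contDiffAt
      · exact (analyticAt_const.mul hg).contDiffAt
    rw [h3, e₂, e₁] at h2
    have hn : ((n + 1 : ℕ) : ℂ) ≠ 0 := Nat.cast_ne_zero.2 n.succ_ne_zero
    have h4 := mul_left_cancel₀ hn h2
    push_cast at h4
    linear_combination h4
  have hD : ∀ n : ℕ, iteratedDeriv n g 0 / n.factorial =
      ordinaryHypergeometricCoefficient a b 1 n := by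
    intro n
    unfold ordinaryHypergeometricCoefficient
    rw [ascPochhammer_eval_one]
    have : ∀ n : ℕ, iteratedDeriv n g 0 * n.factorial = (ascPochhammer ℂ n).eval a *
        (ascPochhammer ℂ n).eval b := by
      intro n
      induction n with
      | zero => simp [h0]
      | succ n ih =>
        rw [ascPochhammer_succ_eval, ascPochhammer_succ_eval, Nat.factorial_succ]
        push_cast
        linear_combination (n.factorial : ℂ) * hrec n + (a + n) * (b + n) * ih
    have hn : (n.factorial : ℂ) ≠ 0 := Nat.cast_ne_zero.2 n.factorial_ne_zero
    field_simp
    linear_combination this n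
  have hs := hg.hasFPowerSeriesAt
  have hh := (hasFPowerSeriesAt_ordinaryHypergeometric hab).hasFPowerSeriesAt
  simp only [hD] at hs
  filter_upwards [hs.eventually_hasSum, hh.eventually_hasSum] with w h1 h2
  rw [zero_add] at h1 h2
  exact h1.unique h2

end Hypergeometric

/-! ### Ramanujan's equations in the coordinate `q` -/

section Cusp

open UpperHalfPlane hiding I
open Complex ModularForm EisensteinSeries Filter Topology Derivative
open scoped Manifold MatrixGroups Real

local notation "𝕢" => Function.Periodic.qParam

/-- Every `q ≠ 0` in the unit disc comes from some `τ`. Continuity of both sides adds `q = 0`. -/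
theorem eventually_mul_deriv_cuspFunction {f : ℍ → ℂ} {F : ℂ → ℂ}
    (hper : Function.Periodic (f ∘ ofComplex) (1 : ℝ)) (hf : MDiff f) (hb : IsBoundedAtImInfty f)
    (hF : ContinuousAt F 0) (h : ∀ τ : ℍ, normalizedDerivOfComplex f τ = F (𝕢 1 τ)) :
    ∀ᶠ q in 𝓝 (0 : ℂ), q * deriv (cuspFunction 1 f) q = F q := by
  have ha := (analyticAt_cuspFunction_zero one_pos hper hf hb).deriv.continuousAt
  have h1 : (fun q => q * deriv (cuspFunction 1 f) q) =ᶠ[𝓝[≠] 0] F := by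
    filter_upwards [self_mem_nhdsWithin, mem_nhdsWithin_of_mem_nhds (Metric.ball_mem_nhds 0 one_pos)]
      with q hq0 hq1
    have him := Function.Periodic.im_invQParam_pos_of_norm_lt_one one_pos
      (by simpa using hq1) hq0
    have hq := Function.Periodic.qParam_right_inv one_ne_zero hq0
    have := normalizedDerivOfComplex_eq_cuspFunction hper hf hb ⟨_, him⟩
    rw [h, coe_mk, hq] at this
    exact this.symm
  exact ((continuousAt_id.mul ha).eventuallyEq_nhds_iff_eventuallyEq_nhdsNE hF).1 h1

theorem periodic_modularForm {k : ℤ} (f : ModularForm 𝒮ℒ k) :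
    Function.Periodic (f ∘ ofComplex) (1 : ℝ) :=
  SlashInvariantFormClass.periodic_comp_ofComplex f one_mem_strictPeriods_SL

theorem cuspFunction_modularForm {k : ℤ} (f : ModularForm 𝒮ℒ k) (τ : ℍ) :
    cuspFunction 1 f (𝕢 1 τ) = f τ :=
  eq_cuspFunction τ one_ne_zero (periodic_modularForm f)

theorem analyticAt_cuspFunction_modularForm {k : ℤ} (f : ModularForm 𝒮ℒ k) :
    AnalyticAt ℂ (cuspFunction 1 f) 0 :=
  ModularFormClass.analyticAt_cuspFunction_zero f one_pos one_mem_strictPeriods_SL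

theorem cuspFunction_modularForm_zero {k : ℤ} (f : ModularForm 𝒮ℒ k) :
    cuspFunction 1 f 0 = (qExpansion 1 f).coeff 0 := by
  simp [qExpansion_coeff]

theorem deriv_cuspFunction_modularForm_zero {k : ℤ} (f : ModularForm 𝒮ℒ k) :
    deriv (cuspFunction 1 f) 0 = (qExpansion 1 f).coeff 1 := by
  simp [qExpansion_coeff]

theorem analyticAt_cuspFunction_E₂ : AnalyticAt ℂ (cuspFunction 1 E2) 0 :=
  analyticAt_cuspFunction_zero one_pos periodic_E₂ E2_mdifferentiable isBoundedAtImInfty_E2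

theorem ramanujan_E₄ : ∀ᶠ q in 𝓝 (0 : ℂ), q * deriv (cuspFunction 1 E₄) q =
    (cuspFunction 1 E2 q * cuspFunction 1 E₄ q - cuspFunction 1 E₆ q) / 3 := by
  refine eventually_mul_deriv_cuspFunction (periodic_modularForm E₄) E₄.holo'
    (ModularFormClass.bdd_at_infty E₄)
    (((analyticAt_cuspFunction_E₂.mul (analyticAt_cuspFunction_modularForm E₄)).sub
      (analyticAt_cuspFunction_modularForm E₆)).continuousAt.div_const 3) fun τ => ?_
  rw [normalizedDerivOfComplex_E₄]
  beta_reduce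
  rw [cuspFunction_modularForm, cuspFunction_modularForm,
    eq_cuspFunction τ one_ne_zero periodic_E₂]

theorem ramanujan_E₆ : ∀ᶠ q in 𝓝 (0 : ℂ), q * deriv (cuspFunction 1 E₆) q =
    (cuspFunction 1 E2 q * cuspFunction 1 E₆ q - cuspFunction 1 E₄ q ^ 2) / 2 := by
  refine eventually_mul_deriv_cuspFunction (periodic_modularForm E₆) E₆.holo'
    (ModularFormClass.bdd_at_infty E₆)
    (((analyticAt_cuspFunction_E₂.mul (analyticAt_cuspFunction_modularForm E₆)).sub
      ((analyticAt_cuspFunction_modularForm E₄).pow 2)).continuousAt.div_const 2) fun τ => ?_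
  rw [normalizedDerivOfComplex_E₆]
  beta_reduce
  rw [cuspFunction_modularForm, cuspFunction_modularForm,
    eq_cuspFunction τ one_ne_zero periodic_E₂]

theorem ramanujan_E₂ : ∀ᶠ q in 𝓝 (0 : ℂ), q * deriv (cuspFunction 1 E2) q =
    (cuspFunction 1 E2 q ^ 2 - cuspFunction 1 E₄ q) / 12 := by
  refine eventually_mul_deriv_cuspFunction periodic_E₂ E2_mdifferentiable
    isBoundedAtImInfty_E2
    (((analyticAt_cuspFunction_E₂.pow 2).sub
      (analyticAt_cuspFunction_modularForm E₄)).continuousAt.div_const 12) fun τ => ?_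
  rw [normalizedDerivOfComplex_E₂]
  beta_reduce
  rw [cuspFunction_modularForm, eq_cuspFunction τ one_ne_zero periodic_E₂]

end Cusp

/-! ### From Ramanujan's equations to `₂F₁(1/12, 5/12; 1; ·)` -/

section Hypergeometric

open Filter Topology

theorem hasDerivAt_one_sub_sq_div_cube {Q R : ℂ → ℂ} {q : ℂ} (h1 : AnalyticAt ℂ Q q)
    (h2 : AnalyticAt ℂ R q) (h3 : Q q ≠ 0) :
    HasDerivAt (fun q => 1 - R q ^ 2 / Q q ^ 3) (-(2 * R q * deriv R q * Q q ^ 3 -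
      R q ^ 2 * (3 * Q q ^ 2 * deriv Q q)) / (Q q ^ 3) ^ 2) q := by
  have := ((h2.differentiableAt.hasDerivAt.fun_pow 2).fun_div
    (h1.differentiableAt.hasDerivAt.fun_pow 3) (pow_ne_zero 3 h3)).const_sub 1
  convert! this using 1
  push_cast
  ring

/-- Ramanujan's differential equations imply that the fourth power of `₂F₁(1/12, 5/12; 1; ·)` at
`1728 / j` is `E₄`. -/
theorem ordinaryHypergeometric_of_ramanujan {P Q R : ℂ → ℂ} (aP : AnalyticAt ℂ P 0)
    (aQ : AnalyticAt ℂ Q 0) (aR : AnalyticAt ℂ R 0) (hQ : Q 0 = 1) (hR : R 0 = 1)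
    (hQ' : deriv Q 0 = 240) (hR' : deriv R 0 = -504)
    (dP : ∀ᶠ q in 𝓝 (0 : ℂ), q * deriv P q = (P q ^ 2 - Q q) / 12)
    (dQ : ∀ᶠ q in 𝓝 (0 : ℂ), q * deriv Q q = (P q * Q q - R q) / 3)
    (dR : ∀ᶠ q in 𝓝 (0 : ℂ), q * deriv R q = (P q * R q - Q q ^ 2) / 2) :
    ∀ᶠ q in 𝓝 (0 : ℂ),
      ordinaryHypergeometric (1 / 12 : ℂ) (5 / 12) 1 (1 - R q ^ 2 / Q q ^ 3) ^ 4 = Q q := by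
  have hQ0 : ∀ᶠ q in 𝓝 (0 : ℂ), Q q ≠ 0 := aQ.continuousAt.eventually_ne (by simp [hQ])
  have hR0 : ∀ᶠ q in 𝓝 (0 : ℂ), R q ≠ 0 := aR.continuousAt.eventually_ne (by simp [hR])
  have aP' := aP.eventually_analyticAt
  have aQ' := aQ.eventually_analyticAt
  have aR' := aR.eventually_analyticAt
  have hdW := fun q (h1 : AnalyticAt ℂ Q q) (h2 : AnalyticAt ℂ R q) (h3 : Q q ≠ 0) =>
    hasDerivAt_one_sub_sq_div_cube h1 h2 h3
  set W : ℂ → ℂ := fun q => 1 - R q ^ 2 / Q q ^ 3 with hWdef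
  have hW0 : W 0 = 0 := by simp [hWdef, hQ, hR]
  have aW : AnalyticAt ℂ W 0 :=
    analyticAt_const.sub ((aR.pow 2).div (aQ.pow 3) (by simp [hQ]))
  -- The value is `-(2·(-504) - 3·240) = 1728`, so `W = 1/J` is a local coordinate at the cusp, with
  -- inverse `V`.
  have hW' : deriv W 0 ≠ 0 := by
    rw [(hdW 0 aQ aR (by simp [hQ])).deriv, hQ, hR, hQ', hR']
    norm_num
  obtain ⟨V, aV, hVW, hWV⟩ : ∃ V : ℂ → ℂ, AnalyticAt ℂ V 0 ∧ (∀ᶠ q in 𝓝 0, V (W q) = q) ∧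
      ∀ᶠ w in 𝓝 0, W (V w) = w := by
    have h1 := aW.analyticAt_localInverse hW'
    have h2 := aW.hasStrictDerivAt.eventually_left_inverse hW'
    have h3 := aW.hasStrictDerivAt.eventually_right_inverse hW'
    rw [hW0] at h1 h3
    exact ⟨_, h1, h2, h3⟩
  have hV0 : V 0 = 0 := by
    have := hVW.self_of_nhds
    rwa [hW0] at this
  have tV : Tendsto V (𝓝 0) (𝓝 0) := by
    have := aV.continuousAt.tendsto
    rwa [hV0] at this
  have tW : Tendsto W (𝓝 0) (𝓝 0) := by
    have := aW.continuousAt.tendsto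
    rwa [hW0] at this
  -- Ramanujan's equations give `q dW/dq = (R/Q) W`. Hence `w d/dw = (Q/R) q d/dq` under `w = W(q)`.
  have hdV : ∀ᶠ w in 𝓝 (0 : ℂ), w * deriv V w = Q (V w) / R (V w) * V w := by
    filter_upwards [hWV.eventually_nhds, aV.eventually_analyticAt, tV.eventually aQ',
      tV.eventually aR', tV.eventually hQ0, tV.eventually hR0, tV.eventually dQ, tV.eventually dR]
      with w h1 h2 h3 h4 h5 h6 h7 h8
    have h9 := ((hdW (V w) h3 h4 h5).comp w h2.differentiableAt.hasDerivAt).congr_of_eventuallyEq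
      (EventuallyEq.symm h1)
    have h10 := h9.unique (hasDerivAt_id w)
    have h11 : w = 1 - R (V w) ^ 2 / Q (V w) ^ 3 := h1.self_of_nhds.symm
    have h12 : w = V w * (-(2 * R (V w) * deriv R (V w) * Q (V w) ^ 3 -
        R (V w) ^ 2 * (3 * Q (V w) ^ 2 * deriv Q (V w))) / (Q (V w) ^ 3) ^ 2) *
        (Q (V w) / R (V w)) := by
      have e : V w * (-(2 * R (V w) * deriv R (V w) * Q (V w) ^ 3 -
        R (V w) ^ 2 * (3 * Q (V w) ^ 2 * deriv Q (V w))) / (Q (V w) ^ 3) ^ 2) =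
        (-(2 * R (V w) * (V w * deriv R (V w)) * Q (V w) ^ 3 -
        R (V w) ^ 2 * (3 * Q (V w) ^ 2 * (V w * deriv Q (V w)))) / (Q (V w) ^ 3) ^ 2) := by ring
      rw [e, h7, h8]
      conv_lhs => rw [h11]
      field_simp
      ring
    linear_combination deriv V w * h12 + (Q (V w) / R (V w) * V w) * h10
  have key : ∀ φ : ℂ → ℂ, AnalyticAt ℂ φ 0 → ∀ᶠ w in 𝓝 (0 : ℂ),
      w * deriv (fun w => φ (V w)) w = Q (V w) / R (V w) * (V w * deriv φ (V w)) := by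
    intro φ aφ
    filter_upwards [hdV, aV.eventually_analyticAt, tV.eventually aφ.eventually_analyticAt]
      with w h1 h2 h3
    have := h3.differentiableAt.hasDerivAt.comp w h2.differentiableAt.hasDerivAt
    rw [show deriv (fun w => φ (V w)) w = _ from this.deriv]
    linear_combination deriv φ (V w) * h1
  let f : ℂ → ℂ := fun q => Q q ^ (1 / 4 : ℂ)
  have aF : AnalyticAt ℂ f 0 := aQ.cpow analyticAt_const (by simp [hQ])
  have hf4 : ∀ q, f q ^ 4 = Q q := fun q => by
    simp [f]
  have hf0 : f 0 = 1 := by simp [f, hQ]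
  have df : ∀ᶠ q in 𝓝 (0 : ℂ), q * deriv f q = f q * ((P q * Q q - R q) / (12 * Q q)) := by
    filter_upwards [aF.eventually_analyticAt, aQ', dQ, hQ0] with q h1 h2 h3 h4
    have h5 := h1.differentiableAt.hasDerivAt.fun_pow 4
    simp only [hf4] at h5
    have h6 := h5.deriv
    have h7 : f q ≠ 0 := fun h => h4 (by rw [← hf4, h]; simp)
    rw [h6] at h3
    push_cast at h3
    field_simp
    rw [← hf4 q] at h3 ⊢
    apply mul_left_cancel₀ (pow_ne_zero 3 h7)
    linear_combination 3 * f q ^ 4 * h3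
  -- This is `(Q/R) q df/dq`, that is, `w d/dw` applied to `f` and expressed in `q`.
  let k : ℂ → ℂ := fun q => f q * (P q * Q q - R q) / (12 * R q)
  have aK : AnalyticAt ℂ k 0 := (aF.mul ((aP.mul aQ).sub aR)).div (analyticAt_const.mul aR)
    (by simp [hR])
  have dk : ∀ᶠ q in 𝓝 (0 : ℂ), q * deriv k q = f q * ((P q * Q q - R q) ^ 2 / (144 * Q q * R q) +
      (P q ^ 2 - Q q) * Q q / (144 * R q) + P q * (P q * Q q - R q) / (36 * R q) -
      P q * Q q * (P q * R q - Q q ^ 2) / (24 * R q ^ 2)) := by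
    filter_upwards [aF.eventually_analyticAt, aP', aQ', aR', dP, dQ, dR, hQ0, hR0, df]
      with q h1 h2 h3 h4 h5 h6 h7 h8 h9 h10
    have h := (h1.differentiableAt.hasDerivAt.fun_mul
      ((h2.differentiableAt.hasDerivAt.fun_mul h3.differentiableAt.hasDerivAt).fun_sub
        h4.differentiableAt.hasDerivAt)).fun_div (h4.differentiableAt.hasDerivAt.const_mul 12)
        (by simpa using h9)
    rw [show deriv k q = _ from h.deriv]
    have e : q * (((deriv f q * (P q * Q q - R q) + f q * (deriv P q * Q q + P q * deriv Q q -
        deriv R q)) * (12 * R q) - f q * (P q * Q q - R q) * (12 * deriv R q)) / (12 * R q) ^ 2) =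
        ((((q * deriv f q) * (P q * Q q - R q) + f q * ((q * deriv P q) * Q q + P q *
        (q * deriv Q q) - (q * deriv R q))) * (12 * R q) -
        f q * (P q * Q q - R q) * (12 * (q * deriv R q))) / (12 * R q) ^ 2) := by ring
    rw [e, h5, h6, h7, h10]
    field_simp
    ring
  have aG : AnalyticAt ℂ (fun w => f (V w)) 0 := by
    rw [← hV0] at aF
    exact aF.comp aV
  have main := eventuallyEq_ordinaryHypergeometric (a := 1 / 12) (b := 5 / 12)
    (g := fun w => f (V w)) (g₁ := fun w => k (V w)) (g₂ := fun w => w * deriv (fun w => k (V w)) w)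
    (fun n => by
      refine ⟨fun h => ?_, fun h => ?_, fun h => ?_⟩
      all_goals
        have := congrArg Complex.re h
        norm_num at this
        have hn : (0 : ℝ) ≤ n := n.cast_nonneg
        linarith) aG (by simp [hV0, hf0]) (by
      filter_upwards [key f aF, tV.eventually df, tV.eventually hQ0, tV.eventually hR0]
        with w h1 h2 h3 h4
      rw [h1, h2]
      simp only [k]
      field_simp) (EventuallyEq.refl _ _) (by
      filter_upwards [key k aK, tV.eventually dk, tV.eventually hQ0, tV.eventually hR0, hWV]
        with w h1 h2 h3 h4 h5
      rw [h1, h2]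
      have h6 : w = 1 - R (V w) ^ 2 / Q (V w) ^ 3 := h5.symm
      simp only [k]
      generalize V w = v at h3 h4 h6 ⊢
      rw [h6]
      field_simp
      ring)
  filter_upwards [tW.eventually main, hVW] with q h1 h2
  change ordinaryHypergeometric (1 / 12 : ℂ) (5 / 12) 1 (W q) ^ 4 = _
  rw [← h1, h2, hf4]

end Hypergeometric

/-! ### The invariant `J`: behaviour at the cusp, properness, surjectivity -/

section KleinInvariant

open UpperHalfPlane hiding I
open Complex ModularForm EisensteinSeries Filter Topology
open scoped Manifold MatrixGroups Real

local notation "𝕢" => Function.Periodic.qParam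

/-- The absolute invariant `J = E₄³ / (E₄³ - E₆²)` on the upper half plane. -/
def kleinJ (τ : ℍ) : ℂ := E₄ τ ^ 3 / (E₄ τ ^ 3 - E₆ τ ^ 2)

theorem E₄_cube_sub_E₆_sq_ne_zero (τ : ℍ) : E₄ τ ^ 3 - E₆ τ ^ 2 ≠ 0 := by
  have h := discriminant_ne_zero τ
  rw [discriminant_eq_E₄_cube_sub_E₆_sq] at h
  intro h0
  rw [h0, zero_div] at h
  exact h rfl

theorem inv_kleinJ {τ : ℍ} (h : E₄ τ ≠ 0) : (kleinJ τ)⁻¹ = 1 - E₆ τ ^ 2 / E₄ τ ^ 3 := by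
  rw [kleinJ, inv_div, sub_div, div_self (pow_ne_zero 3 h)]

theorem cuspFunction_E₄_zero : cuspFunction 1 E₄ 0 = 1 := by
  rw [cuspFunction_modularForm_zero, E_qExpansion_coeff_zero _ ⟨2, rfl⟩]

theorem cuspFunction_E₆_zero : cuspFunction 1 E₆ 0 = 1 := by
  rw [cuspFunction_modularForm_zero, E_qExpansion_coeff_zero _ ⟨3, rfl⟩]

theorem deriv_cuspFunction_E₄_zero : deriv (cuspFunction 1 E₄) 0 = 240 := by
  rw [deriv_cuspFunction_modularForm_zero, E₄_qExpansion_coeff_one]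

theorem deriv_cuspFunction_E₆_zero : deriv (cuspFunction 1 E₆) 0 = -504 := by
  rw [deriv_cuspFunction_modularForm_zero, E₆_qExpansion_coeff_one]

theorem eventually_ordinaryHypergeometric_pow_four :
    ∀ᶠ τ in atImInfty,
      ordinaryHypergeometric (1 / 12 : ℂ) (5 / 12) 1 (kleinJ τ)⁻¹ ^ 4 = E₄ τ := by
  have h := ordinaryHypergeometric_of_ramanujan analyticAt_cuspFunction_E₂
    (analyticAt_cuspFunction_modularForm E₄) (analyticAt_cuspFunction_modularForm E₆)
    cuspFunction_E₄_zero cuspFunction_E₆_zero deriv_cuspFunction_E₄_zero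
    deriv_cuspFunction_E₆_zero ramanujan_E₂ ramanujan_E₄ ramanujan_E₆
  filter_upwards [(qParam_tendsto_atImInfty one_pos).eventually h,
    tendsto_E₄.eventually_ne one_ne_zero] with τ h1 h2
  rwa [cuspFunction_modularForm, cuspFunction_modularForm, ← inv_kleinJ h2] at h1

/-- Every large value of `J` is taken close to the cusp. -/
theorem eventually_exists_kleinJ_eq (Y : ℝ) :
    ∀ᶠ w in 𝓝[≠] (0 : ℂ), ∃ τ : ℍ, Y < τ.im ∧ kleinJ τ = w⁻¹ := by
  have aQ := analyticAt_cuspFunction_modularForm E₄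
  have aR := analyticAt_cuspFunction_modularForm E₆
  have hd := hasDerivAt_one_sub_sq_div_cube aQ aR (by simp [cuspFunction_E₄_zero])
  have aW : AnalyticAt ℂ (fun q => 1 - cuspFunction 1 E₆ q ^ 2 / cuspFunction 1 E₄ q ^ 3) 0 :=
    analyticAt_const.sub ((aR.pow 2).div (aQ.pow 3) (by simp [cuspFunction_E₄_zero]))
  have hm := aW.hasStrictDerivAt.map_nhds_eq (by
    rw [hd.deriv, cuspFunction_E₄_zero, cuspFunction_E₆_zero, deriv_cuspFunction_E₄_zero,
      deriv_cuspFunction_E₆_zero]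
    norm_num)
  rw [cuspFunction_E₄_zero, cuspFunction_E₆_zero, one_pow, one_pow, div_one, sub_self] at hm
  -- Since `|q| = exp(-2π Im τ)`, the second bound on `|q|` says `Im τ > Y`.
  have hN : {q : ℂ | ‖q‖ < min 1 (Real.exp (-2 * π * Y)) ∧ cuspFunction 1 E₄ q ≠ 0} ∈ 𝓝 (0 : ℂ) := by
    refine inter_mem ?_ (aQ.continuousAt.eventually_ne (by simp [cuspFunction_E₄_zero]))
    have := Metric.ball_mem_nhds (0 : ℂ) (ε := min 1 (Real.exp (-2 * π * Y)))
      (lt_min one_pos (Real.exp_pos _))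
    filter_upwards [this] with q hq
    exact mem_ball_zero_iff.1 hq
  have h := image_mem_map (m := fun q => 1 - cuspFunction 1 E₆ q ^ 2 / cuspFunction 1 E₄ q ^ 3) hN
  rw [hm] at h
  filter_upwards [self_mem_nhdsWithin, mem_nhdsWithin_of_mem_nhds h] with w hw0 hw
  obtain ⟨q, ⟨hq1, hq2⟩, rfl⟩ := hw
  have hq0 : q ≠ 0 := by
    rintro rfl
    simp [cuspFunction_E₄_zero, cuspFunction_E₆_zero] at hw0
  have him := Function.Periodic.im_invQParam_pos_of_norm_lt_one one_pos
    (hq1.trans_le (min_le_left _ _)) hq0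
  have hq := Function.Periodic.qParam_right_inv one_ne_zero hq0
  let τ : ℍ := ⟨_, him⟩
  have hτ : 𝕢 1 (τ : ℂ) = q := hq
  refine ⟨τ, ?_, ?_⟩
  · have h1 := hq1.trans_le (min_le_right _ _)
    rw [← hτ, Function.Periodic.norm_qParam, Real.exp_lt_exp, div_one] at h1
    have : 0 < 2 * π := by positivity
    have h2 : 2 * π * Y < 2 * π * (τ : ℂ).im := by linarith
    exact lt_of_mul_lt_mul_left h2 this.le
  · rw [← hτ, cuspFunction_modularForm] at hq2
    beta_reduce
    rw [← hτ, cuspFunction_modularForm, cuspFunction_modularForm, ← inv_kleinJ hq2, inv_inv]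

theorem modularForm_smul {k : ℤ} (f : ModularForm 𝒮ℒ k) (γ : SL(2, ℤ)) (τ : ℍ) :
    f (γ • τ) = f τ * denom γ τ ^ k := by
  have h := congrFun (slash_modularForm f γ) τ
  rw [SL_slash_apply, zpow_neg] at h
  rw [← h, inv_mul_cancel_right₀ (zpow_ne_zero _ (denom_ne_zero _ _))]

theorem kleinJ_smul (γ : SL(2, ℤ)) (τ : ℍ) : kleinJ (γ • τ) = kleinJ τ := by
  have hd : (denom γ τ : ℂ) ^ 12 ≠ 0 := pow_ne_zero _ (denom_ne_zero _ _)
  have h1 : E₄ (γ • τ) ^ 3 = E₄ τ ^ 3 * denom γ τ ^ 12 := by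
    rw [modularForm_smul, mul_pow, ← zpow_natCast (_ ^ (4 : ℤ)), ← zpow_mul]
    norm_cast
  have h2 : E₆ (γ • τ) ^ 2 = E₆ τ ^ 2 * denom γ τ ^ 12 := by
    rw [modularForm_smul, mul_pow, ← zpow_natCast (_ ^ (6 : ℤ)), ← zpow_mul]
    norm_cast
  rw [kleinJ, h1, h2, ← sub_mul, mul_div_mul_right _ _ hd, kleinJ]

theorem differentiableAt_kleinJ (τ : ℍ) : DifferentiableAt ℂ (kleinJ ∘ ofComplex) τ :=
  ((differentiableAt_comp_ofComplex E₄.holo' τ).pow 3).div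
    (((differentiableAt_comp_ofComplex E₄.holo' τ).pow 3).sub
    ((differentiableAt_comp_ofComplex E₆.holo' τ).pow 2)) (by
      simpa using E₄_cube_sub_E₆_sq_ne_zero τ)

theorem continuous_kleinJ : Continuous kleinJ := by
  have h4 : Continuous E₄ := E₄.holo'.continuous
  have h6 : Continuous E₆ := E₆.holo'.continuous
  exact (h4.pow 3).div ((h4.pow 3).sub (h6.pow 2)) E₄_cube_sub_E₆_sq_ne_zero

theorem tendsto_kleinJ : Tendsto kleinJ atImInfty (Bornology.cobounded ℂ) := by
  have h0 : Tendsto (fun τ => (E₄ τ ^ 3 - E₆ τ ^ 2) / E₄ τ ^ 3) atImInfty (𝓝 0) := by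
    have := ((tendsto_E₄.pow 3).sub (tendsto_E₆.pow 2)).div (tendsto_E₄.pow 3) (by norm_num)
    rw [one_pow, one_pow, sub_self, zero_div] at this
    exact this
  have h1 : Tendsto (fun τ => (E₄ τ ^ 3 - E₆ τ ^ 2) / E₄ τ ^ 3) atImInfty (𝓝[≠] 0) := by
    refine tendsto_nhdsWithin_iff.2 ⟨h0, ?_⟩
    filter_upwards [tendsto_E₄.eventually_ne one_ne_zero] with τ h
    exact div_ne_zero (E₄_cube_sub_E₆_sq_ne_zero τ) (pow_ne_zero 3 h)
  refine (tendsto_inv₀_nhdsNE_zero.comp h1).congr fun τ => ?_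
  simp [kleinJ]

/-- A sequence on which `J` converges has a subsequence converging modulo `SL(2, ℤ)`. -/
theorem exists_tendsto_smul {τ : ℕ → ℍ} {w : ℂ} (h : Tendsto (fun n => kleinJ (τ n)) atTop (𝓝 w)) :
    ∃ (γ : ℕ → SL(2, ℤ)) (σ : ℍ) (φ : ℕ → ℕ), StrictMono φ ∧
      Tendsto (fun n => γ (φ n) • τ (φ n)) atTop (𝓝 σ) ∧ kleinJ σ = w := by
  choose γ hγ using fun n => ModularGroup.exists_smul_mem_fd (τ n)
  -- `J` tends to infinity at the cusp, so points of the fundamental domain where `J` is bounded lie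
  -- in a compact truncation.
  have hb : ∀ᶠ τ in atImInfty, kleinJ τ ∉ Metric.closedBall w 1 :=
    tendsto_kleinJ.eventually (Bornology.isBounded_def.1
      (Metric.isBounded_closedBall (x := w) (r := 1)))
  obtain ⟨A, hA⟩ := (atImInfty_mem _).1 hb
  have hev : ∀ᶠ n in atTop, γ n • τ n ∈ ModularGroup.truncatedFundamentalDomain A := by
    filter_upwards [h.eventually (Metric.closedBall_mem_nhds w one_pos)] with n hn
    refine ⟨hγ n, le_of_not_gt fun hlt => hA _ hlt.le ?_⟩
    rwa [kleinJ_smul]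
  obtain ⟨σ, -, φ, hφ, hlim⟩ :=
    (ModularGroup.isCompact_truncatedFundamentalDomain A).isSeqCompact.subseq_of_frequently_in
      hev.frequently
  refine ⟨γ, σ, φ, hφ, hlim, tendsto_nhds_unique ((continuous_kleinJ.tendsto σ).comp hlim) ?_⟩
  exact (h.comp hφ.tendsto_atTop).congr fun n => (kleinJ_smul (γ (φ n)) (τ (φ n))).symm

theorem analyticOnNhd_comp_ofComplex {f : ℍ → ℂ} (hf : MDiff f) :
    AnalyticOnNhd ℂ (f ∘ ofComplex) upperHalfPlaneSet :=
  (UpperHalfPlane.mdifferentiable_iff.1 hf).analyticOnNhd isOpen_upperHalfPlaneSet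

theorem mdifferentiable_kleinJ : MDiff kleinJ := fun τ =>
  UpperHalfPlane.mdifferentiableAt_iff.2 (differentiableAt_kleinJ τ)

/-- `J` is an open map. -/
theorem nhds_le_map_kleinJ (τ : ℍ) : 𝓝 (kleinJ τ) ≤ map kleinJ (𝓝 τ) := by
  have ha := analyticOnNhd_comp_ofComplex mdifferentiable_kleinJ
  have hpre : IsPreconnected upperHalfPlaneSet := (convex_halfSpace_im_gt 0).isPreconnected
  rcases (ha τ τ.im_pos).eventually_constant_or_nhds_le_map_nhds with h | h
  · exfalso
    have hconst := ha.eqOn_of_preconnected_of_eventuallyEq (g := fun _ => (kleinJ ∘ ofComplex) τ)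
      (fun _ _ => analyticAt_const) hpre τ.im_pos h
    have hev : ∀ᶠ σ in atImInfty, kleinJ σ ≠ kleinJ τ := tendsto_kleinJ.eventually_ne_cobounded _
    have : NeBot atImInfty := by infer_instance
    obtain ⟨σ, hσ⟩ := hev.exists
    apply hσ
    simpa using hconst σ.im_pos
  · rw [Function.comp_apply, ofComplex_apply] at h
    refine h.trans ?_
    rw [← Filter.map_map]
    refine map_mono ?_
    have := (contMDiffAt_ofComplex (n := 0) τ.im_pos).continuousAt
    have h2 := this.tendsto
    rwa [ofComplex_apply] at h2

/-- The image is open because `J` is an open map and closed by compactness modulo `SL(2, ℤ)`, and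
`ℂ` is connected. -/
theorem kleinJ_surjective : Function.Surjective kleinJ := by
  have hopen : IsOpen (Set.range kleinJ) := by
    rw [isOpen_iff_mem_nhds]
    rintro _ ⟨τ, rfl⟩
    exact nhds_le_map_kleinJ τ (by
      rw [mem_map]
      exact univ_mem' fun σ => ⟨σ, rfl⟩)
  have hclosed : IsClosed (Set.range kleinJ) := by
    refine IsSeqClosed.isClosed fun u w hu hw => ?_
    choose τ hτ using hu
    obtain ⟨_, σ, _, _, _, hσ⟩ := exists_tendsto_smul (τ := τ) (w := w) (by simpa [hτ] using hw)
    exact ⟨σ, hσ⟩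
  rw [← Set.range_eq_univ]
  exact IsClopen.eq_univ ⟨hclosed, hopen⟩ (Set.range_nonempty kleinJ)

end KleinInvariant

/-! ### Analytic continuation of the identity `₂F₁⁴ = E₄` -/

section Continuation

open UpperHalfPlane hiding I
open Complex ModularForm EisensteinSeries Filter Topology
open scoped Manifold MatrixGroups Real

/-- The germ of `φ` at `w` is, through `w = 1 / J`, a fourth root of `E₄`. -/
def IsFourthRootGerm (φ : ℂ → ℂ) (w : ℂ) : Prop :=
  ∃ τ : ℍ, kleinJ τ = w⁻¹ ∧ ∀ᶠ σ in 𝓝 τ, φ (kleinJ σ)⁻¹ ^ 4 = E₄ σ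

theorem IsFourthRootGerm.pow_four {φ : ℂ → ℂ} {w : ℂ} (h : IsFourthRootGerm φ w) :
    ∃ τ : ℍ, kleinJ τ = w⁻¹ ∧ φ w ^ 4 = E₄ τ := by
  obtain ⟨τ, h1, h2⟩ := h
  refine ⟨τ, h1, ?_⟩
  have := h2.self_of_nhds
  rwa [h1, inv_inv] at this

theorem tendsto_inv_kleinJ {τ : ℍ} {w : ℂ} (hw : w ≠ 0) (h : kleinJ τ = w⁻¹) :
    Tendsto (fun σ => (kleinJ σ)⁻¹) (𝓝 τ) (𝓝 w) := by
  have := (continuous_kleinJ.tendsto τ).inv₀ (by rw [h]; exact inv_ne_zero hw)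
  rwa [h, inv_inv] at this

theorem IsFourthRootGerm.congr {φ ψ : ℂ → ℂ} {w : ℂ} (hw : w ≠ 0) (h : IsFourthRootGerm φ w)
    (e : ψ =ᶠ[𝓝 w] φ) : IsFourthRootGerm ψ w := by
  obtain ⟨τ, h1, h2⟩ := h
  refine ⟨τ, h1, ?_⟩
  filter_upwards [h2, (tendsto_inv_kleinJ hw h1).eventually e] with σ h3 h4
  rw [h4, h3]

/-- `J` is open, so the points near `τ` provide witnesses over a whole neighbourhood of `w`. -/
theorem IsFourthRootGerm.eventually {φ : ℂ → ℂ} {w : ℂ} (hw : w ≠ 0) (h : IsFourthRootGerm φ w) :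
    ∀ᶠ u in 𝓝 w, IsFourthRootGerm φ u := by
  obtain ⟨τ, h1, h2⟩ := h
  have h3 := nhds_le_map_kleinJ τ (image_mem_map h2.eventually_nhds)
  rw [h1] at h3
  filter_upwards [(tendsto_inv₀ hw).eventually h3] with u hu
  obtain ⟨σ, h4, h5⟩ := hu
  exact ⟨σ, h5, h4⟩

theorem mdifferentiable_SL_smul (g : SL(2, ℤ)) : MDiff fun τ : ℍ => g • τ :=
  UpperHalfPlane.mdifferentiable_smul (g := (g : GL (Fin 2) ℝ)) (by simp)

/-- Being a fourth root of `E₄` is a closed condition on germs of one analytic function. -/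
theorem IsFourthRootGerm.of_tendsto {φ : ℂ → ℂ} {w : ℂ} (hw : w ≠ 0) (hφ : AnalyticAt ℂ φ w)
    {u : ℕ → ℂ} (hu : Tendsto u atTop (𝓝 w)) (h : ∀ n, IsFourthRootGerm φ (u n)) :
    IsFourthRootGerm φ w := by
  choose τ h1 h2 using h
  obtain ⟨γ, σ, k, hk, hlim, hσ⟩ := exists_tendsto_smul (τ := τ) (w := w⁻¹)
    (by simpa only [h1] using hu.inv₀ hw)
  have hJσ := tendsto_inv_kleinJ hw hσ
  have hofc : Tendsto ofComplex (𝓝 (σ : ℂ)) (𝓝 σ) := by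
    have := ((contMDiffAt_ofComplex (n := 0) σ.im_pos).continuousAt).tendsto
    rwa [ofComplex_apply] at this
  have hev : ∀ᶠ z in 𝓝 (σ : ℂ), 0 < z.im ∧ AnalyticAt ℂ φ (kleinJ (ofComplex z))⁻¹ ∧
      kleinJ (ofComplex z) ≠ 0 := by
    refine Eventually.and (isOpen_upperHalfPlaneSet.mem_nhds σ.im_pos)
      (((hJσ.comp hofc).eventually hφ.eventually_analyticAt).and ?_)
    have := (continuous_kleinJ.tendsto σ).comp hofc
    rw [hσ] at this
    exact this.eventually_ne (inv_ne_zero hw)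
  obtain ⟨δ, hδ, hball⟩ := Metric.eventually_nhds_iff_ball.1 hev
  have hmem : ∀ᶠ n in atTop, ((γ (k n) • τ (k n) : ℍ) : ℂ) ∈ Metric.ball (σ : ℂ) δ :=
    ((continuous_coe.tendsto σ).comp hlim).eventually (Metric.ball_mem_nhds _ hδ)
  obtain ⟨n, hn⟩ := hmem.exists
  set g := γ (k n)
  set t := τ (k n)
  have ha1 : AnalyticOnNhd ℂ (fun z => φ (kleinJ (ofComplex z))⁻¹ ^ 4) (Metric.ball (σ : ℂ) δ) := by
    intro z hz
    obtain ⟨hz1, hz2, hz3⟩ := hball z hz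
    exact (hz2.comp_of_eq ((analyticOnNhd_comp_ofComplex mdifferentiable_kleinJ z hz1).inv hz3)
      rfl).pow 4
  -- Only `J` is invariant under `g`, so moving the relation from `t` to `g • t` replaces `E₄` by
  -- `E₄ ∘ g⁻¹`. Both sides are analytic on a ball containing `g • t` and `σ`, so the relation
  -- passes to `σ`; moving back gives the witness `g⁻¹ • σ`.
  have ha2 : AnalyticOnNhd ℂ (fun z => E₄ (g⁻¹ • ofComplex z)) (Metric.ball (σ : ℂ) δ) := by
    intro z hz
    obtain ⟨hz1, -, -⟩ := hball z hz
    have := analyticOnNhd_comp_ofComplex (f := fun σ => E₄ (g⁻¹ • σ))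
      (E₄.holo'.comp (mdifferentiable_SL_smul g⁻¹)) z hz1
    exact this
  have heq := ha1.eqOn_of_preconnected_of_eventuallyEq ha2
    (convex_ball (σ : ℂ) δ).isPreconnected hn (by
      have hofc' : Tendsto ofComplex (𝓝 ((g • t : ℍ) : ℂ)) (𝓝 (g • t)) := by
        have := ((contMDiffAt_ofComplex (n := 0) (g • t).im_pos).continuousAt).tendsto
        rwa [ofComplex_apply] at this
      have hg : Tendsto (fun s : ℍ => g⁻¹ • s) (𝓝 (g • t)) (𝓝 t) := by
        have := (mdifferentiable_SL_smul g⁻¹).continuous.tendsto (g • t)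
        rwa [inv_smul_smul] at this
      filter_upwards [(hg.comp hofc').eventually (h2 (k n))] with z hz
      simpa only [Function.comp_apply, kleinJ_smul] using hz)
  refine ⟨g⁻¹ • σ, by rw [kleinJ_smul, hσ], ?_⟩
  have hg : Tendsto (fun s : ℍ => ((g • s : ℍ) : ℂ)) (𝓝 (g⁻¹ • σ)) (𝓝 (σ : ℂ)) := by
    have := (continuous_coe.comp (mdifferentiable_SL_smul g).continuous).tendsto (g⁻¹ • σ)
    rw [Function.comp_apply, smul_inv_smul] at this
    exact this
  filter_upwards [hg.eventually (Metric.ball_mem_nhds _ hδ)] with s hs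
  have := heq hs
  simpa only [ofComplex_apply, kleinJ_smul, inv_smul_smul] using this

/-- The times at which the germ is a fourth root of `E₄` form a nonempty clopen subset of the
interval. -/
theorem IsFourthRootGerm.continuation {p : C(unitInterval, ℂ)} {F : unitInterval → ℂ → ℂ}
    (hp : ∀ t, p t ≠ 0) (hF : ∀ t, AnalyticAt ℂ (F t) (p t))
    (hc : ∀ t, ∀ᶠ s in 𝓝 t, F s =ᶠ[𝓝 (p s)] F t) (h0 : IsFourthRootGerm (F 0) (p 0)) :
    IsFourthRootGerm (F 1) (p 1) := by
  let S : Set unitInterval := {t | IsFourthRootGerm (F t) (p t)}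
  have hopen : IsOpen S := by
    rw [isOpen_iff_mem_nhds]
    intro t ht
    filter_upwards [(p.continuous.tendsto t).eventually (IsFourthRootGerm.eventually (hp t) ht),
      hc t] with s h1 h2
    exact IsFourthRootGerm.congr (hp s) h1 h2
  have hclosed : IsClosed S := by
    refine IsSeqClosed.isClosed fun u t hu ht => ?_
    obtain ⟨N, hN⟩ := eventually_atTop.1 (ht.eventually (hc t))
    refine IsFourthRootGerm.of_tendsto (hp t) (hF t) (u := fun n => p (u (n + N)))
      ((p.continuous.tendsto t).comp ((tendsto_add_atTop_iff_nat N).2 ht)) fun n => ?_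
    exact (hu (n + N)).congr (hp _) (hN (n + N) (Nat.le_add_left N n)).symm
  have := IsClopen.eq_univ ⟨hclosed, hopen⟩ ⟨0, h0⟩
  have h1 : (1 : unitInterval) ∈ S := this ▸ Set.mem_univ _
  exact h1

theorem analyticAt_ordinaryHypergeometric {w : ℂ} (hw : ‖w‖ < 1) :
    AnalyticAt ℂ (ordinaryHypergeometric (1 / 12 : ℂ) (5 / 12) 1) w := by
  refine (hasFPowerSeriesAt_ordinaryHypergeometric (a := (1 / 12 : ℂ)) (b := 5 / 12) (c := 1)
    fun n => ?_).analyticAt_of_mem (?_)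
  · refine ⟨fun h => ?_, fun h => ?_, fun h => ?_⟩
    all_goals
      have := congrArg Complex.re h
      norm_num at this
      have hn : (0 : ℝ) ≤ n := n.cast_nonneg
      linarith
  · rw [← ENNReal.coe_one, Metric.eball_coe, NNReal.coe_one, mem_ball_zero_iff]
    exact hw

/-- The identity is known only near the cusp, that is for small argument. It is carried from `ε w`
to `w` along the radius, where the series itself is the continuation. -/
theorem isFourthRootGerm_ordinaryHypergeometric {w : ℂ} (hw0 : w ≠ 0) (hw : ‖w‖ < 1) :
    IsFourthRootGerm (ordinaryHypergeometric (1 / 12 : ℂ) (5 / 12) 1) w := by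
  obtain ⟨A, hA⟩ := (atImInfty_mem _).1 eventually_ordinaryHypergeometric_pow_four
  have hsmall := eventually_exists_kleinJ_eq A
  have htend : Tendsto (fun ε : ℝ => (ε : ℂ) * w) (𝓝[>] 0) (𝓝[≠] 0) := by
    refine tendsto_nhdsWithin_iff.2 ⟨?_, ?_⟩
    · have : Continuous fun ε : ℝ => (ε : ℂ) * w := by fun_prop
      have := this.tendsto 0
      rw [ofReal_zero, zero_mul] at this
      exact this.mono_left nhdsWithin_le_nhds
    · filter_upwards [self_mem_nhdsWithin] with ε hε
      exact mul_ne_zero (ofReal_ne_zero.2 (ne_of_gt hε)) hw0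
  obtain ⟨ε, ⟨τ, hτ, hJ⟩, hε, hε1⟩ := ((htend.eventually hsmall).and
    (Ioo_mem_nhdsGT one_pos)).exists
  have hstart : IsFourthRootGerm (ordinaryHypergeometric (1 / 12 : ℂ) (5 / 12) 1) (ε * w) := by
    refine ⟨τ, hJ, ?_⟩
    filter_upwards [(UpperHalfPlane.continuous_im.tendsto τ).eventually (lt_mem_nhds hτ)]
      with σ hσ
    exact hA σ hσ.le
  let r : unitInterval → ℝ := fun t => ε + t * (1 - ε)
  have hr : ∀ t, 0 < r t ∧ r t ≤ 1 := fun t =>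
    ⟨by have := t.2.1; simp only [r]; nlinarith, by have := t.2.2; simp only [r]; nlinarith⟩
  let p : C(unitInterval, ℂ) := ⟨fun t => (r t : ℂ) * w, by fun_prop⟩
  have h := IsFourthRootGerm.continuation (p := p)
    (F := fun _ => ordinaryHypergeometric (1 / 12 : ℂ) (5 / 12) 1)
    (fun t => mul_ne_zero (ofReal_ne_zero.2 (hr t).1.ne') hw0)
    (fun t => analyticAt_ordinaryHypergeometric (by
      change ‖(r t : ℂ) * w‖ < 1
      rw [norm_mul, norm_real, Real.norm_of_nonneg (hr t).1.le]
      exact (mul_le_of_le_one_left (norm_nonneg w) (hr t).2).trans_lt hw))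
    (fun t => Eventually.of_forall fun s => EventuallyEq.refl _ _)
    (by simpa [p, r] using hstart)
  simpa [p, r] using h

/-- The fourth power of a value of `₂F₁(1/12, 5/12; 1; ·)` at `1 / J(τ)` is `E₄(τ)`. -/
theorem IsHypergeometricValue.exists_pow_four_eq {w v : ℂ}
    (h : IsHypergeometricValue (1 / 12) (5 / 12) 1 w v) :
    ∃ τ : ℍ, kleinJ τ = w⁻¹ ∧ v ^ 4 = E₄ τ := by
  obtain ⟨p, F, h0, hp, rfl, hF, rfl⟩ := h
  have hstart := (isFourthRootGerm_ordinaryHypergeometric (hp 0).1 h0).congr (hp 0).1 hF.start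
  exact (hstart.continuation (fun t => (hp t).1) hF.analyticAt hF.compatible).pow_four

end Continuation

/-! ### Existence of a value at every point other than `0` and `1` -/

section Existence

open UpperHalfPlane hiding I
open Complex ModularForm EisensteinSeries Filter Topology Derivative
open scoped Manifold MatrixGroups Real

/-- In `f⁴ - g⁴ = (f - g)(f + g)(f² + g²)` the last two factors have product `4g³ ≠ 0` at `x`. -/
theorem eventuallyEq_of_pow_four_eq {X : Type*} [TopologicalSpace X] {f g : X → ℂ} {x : X}
    (hf : ContinuousAt f x) (hg : ContinuousAt g x) (h : ∀ᶠ y in 𝓝 x, f y ^ 4 = g y ^ 4)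
    (h0 : f x = g x) (hne : g x ≠ 0) : f =ᶠ[𝓝 x] g := by
  have hn : (f x + g x) * (f x ^ 2 + g x ^ 2) ≠ 0 := by
    rw [h0, show (g x + g x) * (g x ^ 2 + g x ^ 2) = 4 * g x ^ 3 by ring]
    exact mul_ne_zero (by norm_num) (pow_ne_zero 3 hne)
  have hc : ContinuousAt (fun y => (f y + g y) * (f y ^ 2 + g y ^ 2)) x :=
    (hf.add hg).mul ((hf.pow 2).add (hg.pow 2))
  filter_upwards [h, hc.eventually_ne hn] with y h1 h2
  have : (f y - g y) * ((f y + g y) * (f y ^ 2 + g y ^ 2)) = 0 := by linear_combination h1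
  exact sub_eq_zero.1 ((mul_eq_zero.1 this).resolve_right h2)

/-- Simple connectedness gives a continuous root. It is analytic because near `z` it is a constant
multiple of the principal root of `g / g z`. -/
theorem exists_analytic_fourth_root {N : Set ℂ} (ho : IsOpen N) (hc : Convex ℝ N)
    (hne : N.Nonempty) {g : ℂ → ℂ} (hg : AnalyticOnNhd ℂ g N) (h0 : ∀ z ∈ N, g z ≠ 0) :
    ∃ φ : ℂ → ℂ, AnalyticOnNhd ℂ φ N ∧ ∀ z, φ z ^ 4 = g z := by
  have hs : IsSimplyConnected N := by
    have := hc.contractibleSpace hne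
    exact (inferInstance : SimplyConnectedSpace N)
  obtain ⟨φ, hφ, h4⟩ := Complex.exists_continuousOn_pow_eq hs ho hg.continuousOn
    (by rintro ⟨z, hz, h⟩; exact h0 z hz h) four_ne_zero
  refine ⟨φ, fun z hz => ?_, h4⟩
  have hgz := h0 z hz
  have ha : AnalyticAt ℂ (fun u => φ z * (g u / g z) ^ (1 / 4 : ℂ)) z :=
    analyticAt_const.mul (((hg z hz).div_const).cpow analyticAt_const (by simp [hgz]))
  refine ha.congr ?_
  refine eventuallyEq_of_pow_four_eq ha.continuousAt (hφ.continuousAt (ho.mem_nhds hz))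
    (Eventually.of_forall fun u => ?_) (by simp [hgz]) (fun h => hgz (by rw [← h4, h]; simp))
  have e : ((g u / g z) ^ (1 / 4 : ℂ)) ^ 4 = g u / g z := by
    simp
  rw [mul_pow, e, h4, h4, mul_div_cancel₀ _ hgz]

theorem countable_zeros_of_analyticOnNhd {U : Set ℂ} (hU : IsPreconnected U) {f : ℂ → ℂ}
    (hf : AnalyticOnNhd ℂ f U) {z : ℂ} (hz : z ∈ U) (h : f z ≠ 0) :
    ({z | f z = 0} ∩ U).Countable := by
  have h1 := (hf.eqOn_zero_or_eventually_ne_zero_of_preconnected hU).resolve_left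
    fun h0 => h (h0 hz)
  apply (HereditarilyLindelofSpace.isLindelof _).countable_of_isDiscrete
    (isDiscrete_of_codiscreteWithin _)
  filter_upwards [h1] with z hz hz'
  exact hz hz'

/-- By Ramanujan's equations the derivative is `2πi E₆ (E₄³ - E₆²) / E₄⁴`. -/
theorem deriv_inv_kleinJ_ne_zero {τ : ℍ} (h4 : E₄ τ ≠ 0) (h6 : E₆ τ ≠ 0) :
    deriv (fun z => (kleinJ (ofComplex z))⁻¹) (τ : ℂ) ≠ 0 := by
  have a4 : AnalyticAt ℂ (⇑E₄ ∘ ofComplex) τ :=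
    analyticOnNhd_comp_ofComplex E₄.holo' τ τ.im_pos
  have a6 : AnalyticAt ℂ (⇑E₆ ∘ ofComplex) τ :=
    analyticOnNhd_comp_ofComplex E₆.holo' τ τ.im_pos
  have h4' : (E₄ ∘ ofComplex) τ ≠ 0 := by simpa using h4
  have hd := hasDerivAt_one_sub_sq_div_cube a4 a6 h4'
  have he : (fun z => (kleinJ (ofComplex z))⁻¹) =ᶠ[𝓝 (τ : ℂ)]
      fun z => 1 - (E₆ ∘ ofComplex) z ^ 2 / (E₄ ∘ ofComplex) z ^ 3 := by
    filter_upwards [a4.continuousAt.eventually_ne h4'] with z hz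
    exact inv_kleinJ hz
  rw [he.deriv_eq, hd.deriv]
  have d4 := congrFun normalizedDerivOfComplex_E₄ τ
  have d6 := congrFun normalizedDerivOfComplex_E₆ τ
  rw [normalizedDerivOfComplex, inv_mul_eq_iff_eq_mul₀ two_pi_I_ne_zero] at d4 d6
  rw [d4, d6]
  simp only [Function.comp_apply, ofComplex_apply]
  have e : -(2 * E₆ τ * (2 * π * I * ((E2 τ * E₆ τ - E₄ τ ^ 2) / 2)) * E₄ τ ^ 3 -
      E₆ τ ^ 2 * (3 * E₄ τ ^ 2 * (2 * π * I * ((E2 τ * E₄ τ - E₆ τ) / 3)))) / (E₄ τ ^ 3) ^ 2 =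
      2 * π * I * (E₆ τ * (E₄ τ ^ 3 - E₆ τ ^ 2)) / E₄ τ ^ 4 := by
    field_simp
    ring
  rw [e]
  exact div_ne_zero (mul_ne_zero two_pi_I_ne_zero (mul_ne_zero h6 (E₄_cube_sub_E₆_sq_ne_zero τ)))
    (pow_ne_zero 4 h4)

/-- A point of the upper half plane is joined by a segment, which avoids the zeros of `E₄ E₆`, to
points of large imaginary part. -/
theorem exists_segment_avoiding_zeros {τ : ℍ} (h4 : E₄ τ ≠ 0) (h6 : E₆ τ ≠ 0) (Y : ℝ) :
    ∃ σ : ℍ, Y < σ.im ∧ ∀ z ∈ segment ℝ (σ : ℂ) τ,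
      0 < z.im ∧ E₄ (ofComplex z) * E₆ (ofComplex z) ≠ 0 := by
  have ha : AnalyticOnNhd ℂ (fun z => E₄ (ofComplex z) * E₆ (ofComplex z)) upperHalfPlaneSet :=
    (analyticOnNhd_comp_ofComplex E₄.holo').mul (analyticOnNhd_comp_ofComplex E₆.holo')
  have hZ := countable_zeros_of_analyticOnNhd (convex_halfSpace_im_gt 0).isPreconnected ha
    τ.im_pos (by simpa using ⟨h4, h6⟩)
  set Z := {z | E₄ (ofComplex z) * E₆ (ofComplex z) = 0} ∩ upperHalfPlaneSet
  let y : ℝ := max Y τ.im + 1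
  have hyY : Y < y := (le_max_left _ _).trans_lt (lt_add_one _)
  have hyτ : τ.im < y := (le_max_right _ _).trans_lt (lt_add_one _)
  have hy0 : 0 < y := τ.im_pos.trans hyτ
  -- Projection from `τ` to the horizontal line at height `y`. The zeros are countable, so some `x`
  -- on that line is not the projection of a zero.
  let ρ : ℂ → ℝ := fun z => τ.re + (z.re - τ.re) * ((y - τ.im) / (z.im - τ.im))
  obtain ⟨x, hx⟩ : ∃ x, x ∉ ρ '' Z := ((hZ.image ρ).dense_compl ℝ).nonempty
  let σ : ℍ := ⟨x + y * I, by simpa using hy0⟩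
  have hσre : σ.re = x := by simp [σ, UpperHalfPlane.re]
  have hσim : σ.im = y := by simp [σ, UpperHalfPlane.im]
  refine ⟨σ, by rwa [hσim], fun z hz => ?_⟩
  have him : 0 < z.im := (convex_halfSpace_im_gt 0).segment_subset σ.im_pos τ.im_pos hz
  refine ⟨him, fun h0 => ?_⟩
  obtain ⟨a, b, ha0, hb0, hab, rfl⟩ := hz
  obtain rfl : b = 1 - a := by linarith
  rcases ha0.eq_or_lt with rfl | ha0
  · simp at h0
    tauto
  · refine hx ⟨_, ⟨h0, him⟩, ?_⟩
    have e1 : (a • (σ : ℂ) + (1 - a) • (τ : ℂ)).re = a * x + (1 - a) * τ.re := by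
      simp [hσre]
    have e2 : (a • (σ : ℂ) + (1 - a) • (τ : ℂ)).im = a * y + (1 - a) * τ.im := by
      simp [hσim]
    simp only [ρ]
    rw [e1, e2]
    have h1 : y - τ.im ≠ 0 := by linarith
    have h2 : a * y + (1 - a) * τ.im - τ.im = a * (y - τ.im) := by ring
    rw [h2]
    field_simp
    ring

theorem exists_isHypergeometricValue {w : ℂ} (hw0 : w ≠ 0) (hw1 : w ≠ 1) :
    ∃ v, IsHypergeometricValue (1 / 12) (5 / 12) 1 w v := by
  obtain ⟨τ₁, hτ₁⟩ := kleinJ_surjective w⁻¹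
  have h4 : E₄ τ₁ ≠ 0 := by
    intro h
    rw [kleinJ, h] at hτ₁
    simp at hτ₁
    exact hw0 hτ₁.symm
  have h6 : E₆ τ₁ ≠ 0 := by
    intro h
    rw [kleinJ, h, zero_pow two_ne_zero, sub_zero, div_self (pow_ne_zero 3 h4)] at hτ₁
    exact hw1 (by rw [← inv_inv w, ← hτ₁, inv_one])
  have hlarge : ∀ᶠ τ in atImInfty, ‖(kleinJ τ)⁻¹‖ < 1 := by
    have := (tendsto_inv₀_cobounded.comp tendsto_kleinJ).norm
    rw [norm_zero] at this
    exact this.eventually (gt_mem_nhds one_pos)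
  obtain ⟨A, hA⟩ := (atImInfty_mem _).1 (eventually_ordinaryHypergeometric_pow_four.and hlarge)
  obtain ⟨τ₀, hτ₀, hseg⟩ := exists_segment_avoiding_zeros h4 h6 A
  have hcont : ContinuousOn (fun z => E₄ (ofComplex z) * E₆ (ofComplex z)) upperHalfPlaneSet :=
    ((analyticOnNhd_comp_ofComplex E₄.holo').mul
      (analyticOnNhd_comp_ofComplex E₆.holo')).continuousOn
  have hO : IsOpen (upperHalfPlaneSet ∩
      (fun z => E₄ (ofComplex z) * E₆ (ofComplex z)) ⁻¹' {0}ᶜ) :=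
    hcont.isOpen_inter_preimage isOpen_upperHalfPlaneSet isOpen_compl_singleton
  have hcompact : IsCompact (segment ℝ (τ₀ : ℂ) τ₁) := by
    rw [← convexHull_pair]
    exact (Set.toFinite {(τ₀ : ℂ), (τ₁ : ℂ)}).isCompact_convexHull ℝ
  -- A thickening of the segment is open, convex and still free of zeros, so `E₄` has an analytic
  -- fourth root on it.
  obtain ⟨δ, hδ, hN⟩ := hcompact.exists_thickening_subset_open hO fun z hz => hseg z hz
  set N := Metric.thickening δ (segment ℝ (τ₀ : ℂ) τ₁)
  have hsN : segment ℝ (τ₀ : ℂ) τ₁ ⊆ N := Metric.self_subset_thickening hδ _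
  have hNo : IsOpen N := Metric.isOpen_thickening
  have hN4 : ∀ z ∈ N, E₄ (ofComplex z) ≠ 0 := fun z hz => left_ne_zero_of_mul (hN hz).2
  have hN6 : ∀ z ∈ N, E₆ (ofComplex z) ≠ 0 := fun z hz => right_ne_zero_of_mul (hN hz).2
  obtain ⟨φ₀, hφ₀, hφ₀4⟩ := exists_analytic_fourth_root hNo
    ((convex_segment (τ₀ : ℂ) τ₁).thickening δ) ⟨_, hsN (left_mem_segment ℝ _ _)⟩
    (g := fun z => E₄ (ofComplex z))
    (fun z hz => analyticOnNhd_comp_ofComplex E₄.holo' z (hN hz).1) hN4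
  let H : ℂ → ℂ := fun z => (kleinJ (ofComplex z))⁻¹
  have hJ0 : ∀ z ∈ N, kleinJ (ofComplex z) ≠ 0 := fun z hz =>
    div_ne_zero (pow_ne_zero 3 (hN4 z hz)) (E₄_cube_sub_E₆_sq_ne_zero _)
  have hH1 : ∀ z ∈ N, H z ≠ 1 := by
    intro z hz h
    have h1 : (kleinJ (ofComplex z))⁻¹ = 1 := h
    rw [inv_kleinJ (hN4 z hz), sub_eq_self] at h1
    exact div_ne_zero (pow_ne_zero 2 (hN6 z hz)) (pow_ne_zero 3 (hN4 z hz)) h1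
  have hH : AnalyticOnNhd ℂ H N := fun z hz =>
    (analyticOnNhd_comp_ofComplex mdifferentiable_kleinJ z (hN hz).1).inv (hJ0 z hz)
  have hH' : ∀ z ∈ N, deriv H z ≠ 0 := by
    intro z hz
    have := deriv_inv_kleinJ_ne_zero (τ := ofComplex z) (hN4 z hz) (hN6 z hz)
    rwa [ofComplex_apply_of_im_pos (hN hz).1] at this
  have hmap : ∀ z ∈ N, map H (𝓝 z) = 𝓝 (H z) := fun z hz =>
    (hH z hz).hasStrictDerivAt.map_nhds_eq (hH' z hz)
  have hτ₀N : (τ₀ : ℂ) ∈ N := hsN (left_mem_segment ℝ _ _)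
  let h2F1 := ordinaryHypergeometric (𝔸 := ℂ) (1 / 12 : ℂ) (5 / 12) 1
  have hφ₀ne : ∀ z ∈ N, φ₀ z ≠ 0 := fun z hz h => hN4 z hz (by rw [← hφ₀4, h]; simp)
  -- The root of unity that makes the chosen branch agree with the hypergeometric series at the
  -- starting point.
  let ζ := h2F1 (H τ₀) / φ₀ τ₀
  have hHτ₀ : H τ₀ = (kleinJ τ₀)⁻¹ := by simp [H]
  have hnear : ∀ᶠ z in 𝓝 (τ₀ : ℂ), h2F1 (H z) ^ 4 = E₄ (ofComplex z) := by
    have : ContinuousAt ofComplex (τ₀ : ℂ) :=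
      (contMDiffAt_ofComplex (n := 0) τ₀.im_pos).continuousAt
    have h1 := (UpperHalfPlane.continuous_im.tendsto _).comp this.tendsto
    rw [ofComplex_apply] at h1
    filter_upwards [h1.eventually (lt_mem_nhds hτ₀)] with z hz
    exact (hA _ (le_of_lt hz)).1
  have hζ : ζ ^ 4 = 1 := by
    have h1 := hnear.self_of_nhds
    simp only [ζ, div_pow]
    rw [h1, hφ₀4, div_self (hN4 _ hτ₀N)]
  let φ : ℂ → ℂ := fun z => ζ * φ₀ z
  have hφ : AnalyticOnNhd ℂ φ N := fun z hz => analyticAt_const.mul (hφ₀ z hz)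
  have hφ4 : ∀ z, φ z ^ 4 = E₄ (ofComplex z) := fun z => by
    simp only [φ, mul_pow, hζ, one_mul, hφ₀4]
  have hφτ₀ : φ τ₀ = h2F1 (H τ₀) := div_mul_cancel₀ _ (hφ₀ne _ hτ₀N)
  let c : unitInterval → ℂ := fun t => AffineMap.lineMap (τ₀ : ℂ) (τ₁ : ℂ) (t : ℝ)
  have hc : Continuous c := AffineMap.lineMap_continuous.comp continuous_subtype_val
  have hcN : ∀ t, c t ∈ N := fun t => hsN (by
    rw [segment_eq_image_lineMap]
    exact ⟨t, t.2, rfl⟩)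
  have hc0 : c 0 = τ₀ := by simp [c]
  have hc1 : c 1 = τ₁ := by simp [c]
  let p : C(unitInterval, ℂ) := ⟨fun t => H (c t), hH.continuousOn.comp_continuous hc hcN⟩
  choose V hVa hVc hV using fun t : unitInterval => (⟨_,
    (hH (c t) (hcN t)).analyticAt_localInverse (hH' _ (hcN t)),
    ((hH (c t) (hcN t)).hasStrictDerivAt.eventually_left_inverse (hH' _ (hcN t))).self_of_nhds,
    (hH (c t) (hcN t)).hasStrictDerivAt.eventually_left_inverse (hH' _ (hcN t))⟩ :
    ∃ V : ℂ → ℂ, AnalyticAt ℂ V (H (c t)) ∧ V (H (c t)) = c t ∧ ∀ᶠ z in 𝓝 (c t), V (H z) = z)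
  -- `H = 1/J` maps neighbourhoods onto neighbourhoods, so germs downstairs may be compared after
  -- pulling back by `H`.
  have hgerm : ∀ (t : unitInterval) (f g : ℂ → ℂ), (∀ᶠ z in 𝓝 (c t), f (H z) = g (H z)) →
      f =ᶠ[𝓝 (p t)] g := by
    intro t f g h
    change ∀ᶠ u in 𝓝 (H (c t)), f u = g u
    rw [← hmap _ (hcN t)]
    exact h
  -- The continuation at time `t` is `φ` composed with the local inverse of `H` at `c t`.
  refine ⟨φ (V 1 w), p, fun t u => φ (V t u), ?_, fun t => ⟨?_, hH1 _ (hcN t)⟩, ?_,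
    ⟨?_, fun t => ?_, fun t => ?_⟩, rfl⟩
  · change ‖H (c 0)‖ < 1
    rw [hc0, hHτ₀]
    exact (hA _ hτ₀.le).2
  · exact inv_ne_zero (hJ0 _ (hcN t))
  · change H (c 1) = w
    rw [hc1]
    simp [H, hτ₁]
  · refine hgerm 0 _ _ ?_
    have h1 : φ =ᶠ[𝓝 (τ₀ : ℂ)] fun z => h2F1 (H z) := by
      refine eventuallyEq_of_pow_four_eq (hφ _ hτ₀N).continuousAt ?_ ?_ hφτ₀ ?_
      · refine ContinuousAt.comp (g := h2F1) ?_ (hH _ hτ₀N).continuousAt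
        refine (analyticAt_ordinaryHypergeometric ?_).continuousAt
        rw [hHτ₀]
        exact (hA _ hτ₀.le).2
      · filter_upwards [hnear] with z hz
        rw [hz, hφ4]
      · rw [← hφτ₀]
        intro h
        have := hφ4 τ₀
        rw [h] at this
        exact hN4 _ hτ₀N (by rw [← this]; simp)
    have h2 := hV 0
    rw [hc0] at h2 ⊢
    filter_upwards [h1, h2] with z h3 h4
    rw [h4, h3]
  · exact (hφ _ (hcN t)).comp_of_eq (hVa t) (hVc t)
  · filter_upwards [(hc.tendsto t).eventually (hV t).eventually_nhds] with s hs
    refine hgerm s _ _ ?_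
    filter_upwards [hs, hV s] with z h1 h2
    rw [h1, h2]

end Existence

/-! ### Uniformization of the cubic and computation of the period -/

section Uniformization

open UpperHalfPlane hiding I
open Complex ModularForm EisensteinSeries
open scoped Real

theorem riemannZeta_six : riemannZeta 6 = π ^ 6 / 945 := by
  have h := riemannZeta_two_mul_nat (k := 3) three_ne_zero
  have hB : bernoulli 6 = 1 / 42 := by
    rw [bernoulli_eq_bernoulli'_of_ne_one (by norm_num), bernoulli'_def]
    simp only [Finset.sum_range_succ, Finset.sum_range_zero, bernoulli'_zero, bernoulli'_one,
      bernoulli'_two, bernoulli'_three, bernoulli'_four,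
      bernoulli'_eq_zero_of_odd (n := 5) (by decide) (by norm_num)]
    norm_num [Nat.choose]
  norm_num [hB, Nat.factorial] at h
  rw [h]
  ring

namespace PeriodPair

/-- The pair of periods `l`, `l τ`. -/
def ofUpperHalfPlane (l : ℂ) (hl : l ≠ 0) (τ : ℍ) : PeriodPair where
  ω₁ := l
  ω₂ := l * τ
  indep := by
    rw [LinearIndependent.pair_iff]
    intro s t h
    have h1 : (s : ℂ) + t * τ = 0 := by
      apply mul_left_cancel₀ hl
      rw [real_smul, real_smul] at h
      linear_combination h
    have ht : t = 0 := by
      have := congrArg Complex.im h1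
      simpa [τ.im_ne_zero] using this
    exact ⟨by simpa [ht] using h1, ht⟩

variable {l : ℂ} {hl : l ≠ 0} {τ : ℍ}

theorem G_ofUpperHalfPlane {k : ℕ} (hk : 3 ≤ k) : (ofUpperHalfPlane l hl τ).G k =
    (l ^ k)⁻¹ * (2 * riemannZeta k * E hk τ) := by
  have e : 2 * riemannZeta k * E hk τ = ∑' v : Fin 2 → ℤ, eisSummand k v τ := by
    rw [tsum_eisSummand_eq_riemannZeta_mul_eisensteinSeries hk,
      show E hk τ = (1 / 2 : ℂ) * eisensteinSeries (N := 1) 0 k τ from rfl]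
    ring
  -- The swap is needed because `eisSummand` puts the coefficient of `τ` first, while the lattice
  -- coordinates begin with `ω₁ = l`.
  let e1 : (Fin 2 → ℤ) ≃ (ofUpperHalfPlane l hl τ).lattice :=
    (finTwoArrowEquiv ℤ).trans ((Equiv.prodComm ℤ ℤ).trans
      (ofUpperHalfPlane l hl τ).latticeEquivProd.symm.toEquiv)
  rw [e, PeriodPair.G, ← e1.tsum_eq, ← tsum_mul_left]
  refine tsum_congr fun v => ?_
  have : ((e1 v : (ofUpperHalfPlane l hl τ).lattice) : ℂ) = v 1 * l + v 0 * (l * τ) :=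
    (ofUpperHalfPlane l hl τ).latticeEquiv_symm_apply (v 1, v 0)
  rw [this, eisSummand, zpow_neg, zpow_natCast, ← mul_inv, ← mul_pow]
  ring_nf

/-- The constant is `60 · 2ζ(4)`, with `ζ(4) = π⁴/90`. For `g₃` it is `140 · 2ζ(6)`. -/
theorem g₂_ofUpperHalfPlane :
    (ofUpperHalfPlane l hl τ).g₂ = (l ^ 4)⁻¹ * (4 / 3 * π ^ 4 * E₄ τ) := by
  rw [PeriodPair.g₂, G_ofUpperHalfPlane (k := 4) (by norm_num)]
  norm_num [riemannZeta_four]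
  ring

theorem g₃_ofUpperHalfPlane :
    (ofUpperHalfPlane l hl τ).g₃ = (l ^ 6)⁻¹ * (8 / 27 * π ^ 6 * E₆ τ) := by
  rw [PeriodPair.g₃, G_ofUpperHalfPlane (k := 6) (by norm_num)]
  norm_num [riemannZeta_six]
  ring

end PeriodPair

/-- A square root `l` of `B / A` works, since `B²/A² = A` and `B³/A³ = B`. -/
theorem exists_pow_four_eq_and_pow_six_eq {A B : ℂ} (hA : A ≠ 0) (hB : B ≠ 0)
    (h : A ^ 3 = B ^ 2) : ∃ l : ℂ, l ≠ 0 ∧ l ^ 4 = A ∧ l ^ 6 = B := by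
  obtain ⟨l, hl⟩ := IsAlgClosed.exists_pow_nat_eq (B / A) two_pos
  refine ⟨l, ?_, ?_, ?_⟩
  · rintro rfl
    exact div_ne_zero hB hA (by simpa using hl.symm)
  · rw [show l ^ 4 = (l ^ 2) ^ 2 by ring, hl]
    field_simp
    exact h.symm
  · rw [show l ^ 6 = (l ^ 2) ^ 3 by ring, hl, div_pow, h]
    field_simp

/-- A cubic with the `J`-invariant of `τ` is uniformized by a lattice `l (ℤ + ℤ τ)`. -/
theorem WeierstrassCubic.exists_eq_cubic (C : WeierstrassCubic) (hd : C.disc ≠ 0) (hJ0 : C.J ≠ 0)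
    (hJ1 : C.J ≠ 1) {τ : ℍ} (hτ : kleinJ τ = C.J) :
    ∃ (l : ℂ) (hl : l ≠ 0), C = (PeriodPair.ofUpperHalfPlane l hl τ).cubic := by
  have hΔ := E₄_cube_sub_E₆_sq_ne_zero τ
  have h2 : C.g₂ ≠ 0 := fun h => hJ0 (by simp [J, h])
  have h3 : C.g₃ ≠ 0 := fun h => hJ1 (by
    have : C.disc = C.g₂ ^ 3 := by simp [disc, h]
    rw [J, this, div_self (pow_ne_zero 3 h2)])
  have h4 : E₄ τ ≠ 0 := fun h => hJ0 (by simp [← hτ, kleinJ, h])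
  have h6 : E₆ τ ≠ 0 := fun h => hJ1 (by
    rw [← hτ, kleinJ, h, zero_pow two_ne_zero, sub_zero, div_self (pow_ne_zero 3 h4)])
  -- Equality of the `J`-invariants, cleared of denominators, is the compatibility `A³ = B²` needed
  -- for the scaling `l`.
  have hE : 27 * C.g₃ ^ 2 * E₄ τ ^ 3 = C.g₂ ^ 3 * E₆ τ ^ 2 := by
    rw [kleinJ, J, div_eq_div_iff hΔ hd, disc] at hτ
    linear_combination -hτ
  have hpi : (π : ℂ) ≠ 0 := ofReal_ne_zero.2 Real.pi_ne_zero
  obtain ⟨l, hl, hl4, hl6⟩ := exists_pow_four_eq_and_pow_six_eq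
    (A := 4 / 3 * π ^ 4 * E₄ τ / C.g₂) (B := 8 / 27 * π ^ 6 * E₆ τ / C.g₃)
    (by simp [h2, h4, hpi]) (by simp [h3, h6, hpi]) (by
      rw [div_pow, div_pow, div_eq_div_iff (pow_ne_zero 3 h2) (pow_ne_zero 2 h3)]
      linear_combination 64 / 729 * (π : ℂ) ^ 12 * hE)
  refine ⟨l, hl, ?_⟩
  have e2 : C.g₂ = (PeriodPair.ofUpperHalfPlane l hl τ).g₂ := by
    rw [PeriodPair.g₂_ofUpperHalfPlane, hl4]
    field_simp
  have e3 : C.g₃ = (PeriodPair.ofUpperHalfPlane l hl τ).g₃ := by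
    rw [PeriodPair.g₃_ofUpperHalfPlane, hl6]
    field_simp
  change C = ⟨_, _⟩
  rw [← e2, ← e3]

theorem WeierstrassCubic.exists_period_of_isHypergeometricValue (C : WeierstrassCubic)
    (hd : C.disc ≠ 0) (hJ0 : C.J ≠ 0) (hJ1 : C.J ≠ 1) {v : ℂ}
    (hv : IsHypergeometricValue (1 / 12) (5 / 12) 1 (1 / C.J) v) :
    ∃ (γ : C.H₁) (ω : ℂ), IsPrimitiveElement γ ∧ C.HasPeriod γ ω ∧ v ≠ 0 ∧
      C.g₂ * ω ^ 4 = 4 / 3 * π ^ 4 * v ^ 4 := by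
  obtain ⟨τ, hτ, hv4⟩ := hv.exists_pow_four_eq
  rw [one_div, inv_inv] at hτ
  have h4 : E₄ τ ≠ 0 := fun h => hJ0 (by simp [← hτ, kleinJ, h])
  obtain ⟨l, hl, hC⟩ := C.exists_eq_cubic hd hJ0 hJ1 hτ
  have hg : C.g₂ = (l ^ 4)⁻¹ * (4 / 3 * π ^ 4 * E₄ τ) := by
    rw [hC]
    exact PeriodPair.g₂_ofUpperHalfPlane
  clear hτ hv hd hJ0 hJ1
  obtain ⟨γ, hγ, hp⟩ := (PeriodPair.ofUpperHalfPlane l hl τ).exists_primitive_hasPeriod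
  subst hC
  refine ⟨γ, l, hγ, hp, fun h => h4 (by rw [← hv4, h]; simp), ?_⟩
  rw [hg, hv4]
  field_simp

end Uniformization

end

theorem proposition3 {B : Type*} (E : B → WeierstrassCubic) (b : B)
    (hsmooth : (E b).disc ≠ 0) (hJ0 : (E b).J ≠ 0) (hJ1 : (E b).J ≠ 1) :
    (∃ v : ℂ, IsHypergeometricValue (1 / 12) (5 / 12) 1 (1 / (E b).J) v) ∧
    ∀ v : ℂ, IsHypergeometricValue (1 / 12) (5 / 12) 1 (1 / (E b).J) v →
      ∃ (γ : (E b).H₁) (I : ℂ), IsPrimitiveElement γ ∧ (E b).HasPeriod γ I ∧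
        ∀ r : ℂ, r ^ 4 = (E b).g₂ → ∃ ζ : ℂ, ζ ^ 4 = 1 ∧
          r * I = ζ * (((2 * Real.pi / (12 : ℝ) ^ (1 / 4 : ℝ) : ℝ) : ℂ) * v) := by
  refine ⟨exists_isHypergeometricValue (one_div_ne_zero hJ0) fun h => hJ1 ?_, fun v hv => ?_⟩
  · rwa [one_div, inv_eq_one] at h
  obtain ⟨γ, I, hγ, hI, hv0, h⟩ := (E b).exists_period_of_isHypergeometricValue hsmooth hJ0 hJ1 hv
  refine ⟨γ, I, hγ, hI, fun r hr => ?_⟩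
  set c : ℝ := 2 * Real.pi / (12 : ℝ) ^ (1 / 4 : ℝ)
  have hc0 : c ≠ 0 := by positivity
  -- `(2π)⁴ / 12 = (4/3)π⁴` is the constant relating `g₂ l⁴` to `E₄`.
  have hc4 : c ^ 4 = 4 / 3 * Real.pi ^ 4 := by
    have : ((12 : ℝ) ^ (1 / 4 : ℝ)) ^ 4 = 12 := by
      rw [← Real.rpow_natCast, ← Real.rpow_mul (by norm_num)]
      norm_num
    rw [div_pow, this]
    ring
  have hc4' : (c : ℂ) ^ 4 = 4 / 3 * (Real.pi : ℂ) ^ 4 := by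
    rw [← Complex.ofReal_pow, hc4]
    push_cast
    ring
  have hcv : (c : ℂ) * v ≠ 0 := mul_ne_zero (by exact_mod_cast hc0) hv0
  -- Its fourth power is `g₂ I⁴ / (c v)⁴ = 1`.
  refine ⟨r * I / (c * v), ?_, (div_mul_cancel₀ _ hcv).symm⟩
  rw [div_pow, div_eq_one_iff_eq (pow_ne_zero 4 hcv), mul_pow, mul_pow, hr, h, hc4']
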